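/- **Setting.** In the $T$-round online game an oblivious adversary fixes a sequence $S=(x_1,y_1),\dots,(x_T,y_T)\in (X\times\{-1,1\})^T$, $T\ge 1$; in round $t$ the learner sees $x_t$, releases a hypothesis $h_t:X\to\{-1,1\}$, then sees $y_t$, and errs if $h_t(x_t)\ne y_t$. The learner is $(\varepsilon,\delta)$-differentially private if for all $S,S'$ (not necessarily consistent with any function) that differ in a single example and every set $R$ of sequences of released hypotheses, $\Pr[M(S)\in R]\le e^{\varepsilon}\Pr[M(S')\in R]+\delta$. Let $\mathcal F$ be a finite set of Boolean functions on $X$. An $\mathcal F$-decision list of length $r\ge 1$ with $D$ alternations is a list $(f_1,b_1),\dots,(f_{r-1},b_{r-1}),b_r$ with $f_i\in\mathcal F$, $b_i\in\{-1,1\}$, such that $b_i\neq b_{i+1}$ for at most $D$ indices $i$; it computes "if $f_1$ then $b_1$, else if $f_2$ then $b_2$, …, else $b_r$". **Algorithm DP-Winnow** (parameters $\hat\varepsilon,\eta>0$, $L\in\mathbb R$, $m\ge1$, $K\ge 0$; examples in $\{-1,1\}^d\times\{-1,1\}$). Start with $w=\tilde w=(1/d,\dots,1/d)$, an empty cache $C$,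 $k=0$, and noisy threshold $\theta=L+\mathrm{Lap}(2/\hat\varepsilon)$. In round $t$ release $\tilde w$, representing the hypothesis $x\mapsto\operatorname{sgn}\langle\tilde w,x\rangle$ (with $\operatorname{sgn}0=+1$); if it errs on $(x_t,y_t)$, append $(x_t,y_t)$ to $C$. If $|C|+\mathrm{Lap}(4/\hat\varepsilon)\ge\theta$ (fresh noise) and $k<K$, then: take the first example $(\hat x,\hat y)$ in $C$ and replace $w_j$ by $w_je^{\eta\hat y\hat x_j}/\sum_i w_ie^{\eta\hat y\hat x_i}$ (no change if $C$ is empty); draw $j_1,\dots,j_m$ i.i.d. from $w$ and put $\tilde w_j=\#\{i:j_i=j\}/m$; increase $k$ by one, empty $C$, and draw a new $\theta=L+\mathrm{Lap}(2/\hat\varepsilon)$. To learn $\mathcal F$-decision lists, it is run with $d=2(|\mathcal F|+1)$ on the expanded examples $z=(x',-x')$, where $x'$ lists the values at $x$ of all features in $\mathcal F$ followed by the constant $+1$. **Theorem.** There are absolute constants $A,B,a$ such that the following holds for all $N,D\ge 0$, $T,r\ge 1$ and $\varepsilon,\delta,\beta\in(0,1)$. There are parameters $\hat\varepsilon,\eta,L,m,K$,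 depending only on $N,T,r,D,\varepsilon,\delta,\beta$, such that for every set $X$ and every set $\mathcal F$ of $N$ Boolean functions on $X$, DP-Winnow with these parameters is $(\varepsilon,\delta)$-differentially private, and for every sequence $S$ of $T$ examples that is consistent with an $\mathcal F$-decision list of length $r$ with $D$ alternations, with probability at least $1-B\beta$ it makes at most $A\,Q\,\operatorname{Log}(Q)^a$ prediction errors, that is $\tilde O(Q)$ errors, where $$Q=\frac{r^{6D}\cdot\operatorname{Log}^3 |\mathcal F|\cdot\operatorname{Log}^{5/2}(T/\beta)\cdot\operatorname{Log}^2(1/\delta)}{\varepsilon^4},\qquad \operatorname{Log}u=\max(1,\log u).$$ -/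

import Mathlib

open MeasureTheory

universe u v

noncomputable section

namespace DPWinnow

/-! ### Signs

`Bool` encodes `{-1, 1}`: `true` is `+1` and `false` is `-1`. -/

/-- The real number `±1` encoded by a Boolean value. -/
def pm (b : Bool) : ℝ := if b then 1 else -1

open Classical in
/-- The sign of a real number as an element of `{-1, 1}`, with `sgn 0 = +1`. -/
def sgn (a : ℝ) : Bool := decide (0 ≤ a)

/-- A point of `{-1, 1}^ι` together with a label in `{-1, 1}`. -/
abbrev Example (ι : Type u) : Type u := (ι → Bool) × Bool

/-- The halfspace `x ↦ sgn ⟨w, x⟩` on `{-1, 1}^ι`. -/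
def halfspace {ι : Type u} [Fintype ι] (w : ι → ℝ) (x : ι → Bool) : Bool :=
  sgn (∑ j, w j * pm (x j))

/-! ### The algorithm -/

/-- The centred Laplace distribution with scale `b`. -/
def laplace (b : ℝ) : Measure ℝ :=
  volume.withDensity fun x => ENNReal.ofReal (Real.exp (-|x| / b) / (2 * b))

/-- The numerical inputs of DP-Winnow: the privacy parameter `epsHat` of each instance of
AboveThreshold, the learning rate `eta`, the threshold `L`, the number `m` of samples behind each
released weight vector, and the bound `K` on the number of updates. -/
structure Params where
  epsHat : ℝ
  eta : ℝ
  L : ℝ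
  m : ℕ
  K : ℕ
  epsHat_pos : 0 < epsHat
  eta_pos : 0 < eta
  m_pos : 0 < m

/-- The internal state of DP-Winnow: the private weights `w`, the released weights `wt`, the
cache `C` of the examples misclassified since the last update (in order of arrival, so that its
length is the current query to AboveThreshold), the number `k` of updates so far, and the noisy
threshold `thr` of the current instance of AboveThreshold. -/
structure State (ι : Type u) where
  w : ι → ℝ
  wt : ι → ℝ
  C : List (Example ι)
  k : ℕ
  thr : ℝ

/-- The multiplicative weights update of `w` on the example `z = (x, y)` with learning rate
`eta`. -/
def mwUpdate {ι : Type u} [Fintype ι] (eta : ℝ) (w : ι → ℝ) (z : Example ι) : ι → ℝ :=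
  fun j => Real.exp (eta * pm z.2 * pm (z.1 j)) /
    (∑ i, w i * Real.exp (eta * pm z.2 * pm (z.1 i))) * w j

/-- The private weights after an update round in which the cache is `C`: a multiplicative weights
update on the first cached example (nothing is changed if the cache is empty). -/
def updatedWeights {ι : Type u} [Fintype ι] (eta : ℝ) (w : ι → ℝ) (C : List (Example ι)) :
    ι → ℝ :=
  match C.head? with
  | some z => mwUpdate eta w z
  | none => w

open Classical in
/-- The empirical frequencies of the samples `J 0, …, J (m - 1)`. -/
def empirical {ι : Type u} {m : ℕ} (J : Fin m → ι) : ι → ℝ :=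
  fun j => (Finset.univ.filter fun i => J i = j).card / (m : ℝ)

open Classical in
/-- Draw `J 0, …, J (m - 1)` independently from the distribution `w` on `ι` and continue with
`g J`. -/
def sampleThen {ι : Type u} [Fintype ι] {α : Type v} [MeasurableSpace α] (w : ι → ℝ) (m : ℕ)
    (g : (Fin m → ι) → Measure α) : Measure α :=
  ∑ J : Fin m → ι, ENNReal.ofReal (∏ i, w (J i)) • g J

open Classical in
/-- The joint distribution of the hypotheses that DP-Winnow releases on the remaining `T` examples
`S` when it is in state `s`.  In each round it releases `s.wt`, records the example in the cache
if it is misclassified, and asks AboveThreshold (fresh noise `Lap(4 / epsHat)`, compared with the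
noisy threshold) whether the number of errors since the last update is large; if so, and if fewer
than `K` updates were made, it updates the private weights, releases the empirical frequencies of
`m` samples from them from the next round on, empties the cache, and starts a new instance of
AboveThreshold (noisy threshold `L + Lap(2 / epsHat)`). -/
def run {ι : Type u} [Fintype ι] (p : Params) :
    (T : ℕ) → (Fin T → Example ι) → State ι → Measure (Fin T → ι → ℝ)
  | 0, _, _ => Measure.dirac Fin.elim0
  | T + 1, S, s =>
    let C : List (Example ι) :=
      if halfspace s.wt (S 0).1 ≠ (S 0).2 then s.C ++ [S 0] else s.C
    let next : State ι → Measure (Fin (T + 1) → ι → ℝ) := fun s' =>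
      (run p T (Fin.tail S) s').map (Fin.cons s.wt)
    (laplace (4 / p.epsHat)).bind fun ν =>
      if s.thr ≤ (C.length : ℝ) + ν ∧ s.k < p.K then
        sampleThen (updatedWeights p.eta s.w C) p.m fun J =>
          (laplace (2 / p.epsHat)).bind fun ξ =>
            next
              { w := updatedWeights p.eta s.w C
                wt := empirical J
                C := []
                k := s.k + 1
                thr := p.L + ξ }
      else
        next { s with C := C }

/-- DP-Winnow on the sequence `S` of `T` labelled examples: the joint distribution of the released
weight vectors, the `t`-th of which represents the `t`-th hypothesis. -/
def dpWinnow {ι : Type u} [Fintype ι] (p : Params) {T : ℕ} (S : Fin T → Example ι) :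
    Measure (Fin T → ι → ℝ) :=
  (laplace (2 / p.epsHat)).bind fun ξ =>
    run p T S
      { w := fun _ => 1 / (Fintype.card ι : ℝ)
        wt := fun _ => 1 / (Fintype.card ι : ℝ)
        C := []
        k := 0
        thr := p.L + ξ }

/-! ### Decision lists -/

/-- A decision list: rules "if `f₁` then `b₁`, else if `f₂` then `b₂`, …" and a default bit. -/
structure DecisionList (X : Type u) where
  rules : List ((X → Bool) × Bool)
  default : Bool

/-- The value of a list of rules with a default bit at `x`: the bit of the first rule that
applies, and the default bit if there is none. -/
def evalRules {X : Type u} (dflt : Bool) (x : X) : List ((X → Bool) × Bool) → Bool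
  | [] => dflt
  | (f, b) :: l => if f x then b else evalRules dflt x l

/-- The Boolean function computed by a decision list. -/
def DecisionList.eval {X : Type u} (l : DecisionList X) (x : X) : Bool :=
  evalRules l.default x l.rules

/-- The length of a decision list; the default bit counts as its last rule. -/
def DecisionList.length {X : Type u} (l : DecisionList X) : ℕ := l.rules.length + 1

/-- The output bits `b₁, …, b_r` of a decision list, the default bit last. -/
def DecisionList.bits {X : Type u} (l : DecisionList X) : List Bool :=
  l.rules.map Prod.snd ++ [l.default]

/-- The number of indices `i` with `b_i ≠ b_{i+1}`. -/
def DecisionList.alternations {X : Type u} (l : DecisionList X) : ℕ :=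
  (l.bits.zip l.bits.tail).countP fun q => q.1 != q.2

/-- The class of functions computed by `F`-decision lists of length `r` whose output bits
alternate at most `D` times. -/
def decisionLists {X : Type u} (F : Finset (X → Bool)) (r D : ℕ) : Set (X → Bool) :=
  {c | ∃ l : DecisionList X, (∀ q ∈ l.rules, q.1 ∈ F) ∧ l.length = r ∧ l.alternations ≤ D ∧
    l.eval = c}

/-! ### Learning decision lists with DP-Winnow -/

/-- The coordinates of the feature expansion: one for each feature and a constant one, all of
them twice. -/
abbrev Coord {X : Type u} (F : Finset (X → Bool)) : Type u := Option F ⊕ Option F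

/-- The features of `x` and the constant `+1`, as a point of `{-1, 1}^(|F| + 1)`. -/
def features {X : Type u} (F : Finset (X → Bool)) (x : X) : Option F → Bool
  | some f => f.1 x
  | none => true

/-- The feature expansion `z = (x', -x')` in `{-1, 1}^(2 (|F| + 1))` with `x' = features F x`,
through which halfspaces with nonnegative weights represent all halfspaces in `x'`. -/
def expand {X : Type u} (F : Finset (X → Bool)) (x : X) : Coord F → Bool :=
  Sum.elim (features F x) fun i => !(features F x i)

/-- The online learner for `F`-decision lists: DP-Winnow on the expanded examples. -/
def learner {X : Type u} (F : Finset (X → Bool)) (p : Params) {T : ℕ} (S : Fin T → X × Bool) :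
    Measure (Fin T → Coord F → ℝ) :=
  dpWinnow p fun t => (expand F (S t).1, (S t).2)

open Classical in
/-- The number of prediction errors of the hypotheses `x ↦ sgn ⟨h t, expand F x⟩` on `S`. -/
def errors {X : Type u} (F : Finset (X → Bool)) {T : ℕ} (S : Fin T → X × Bool)
    (h : Fin T → Coord F → ℝ) : ℕ :=
  (Finset.univ.filter fun t => halfspace (h t) (expand F (S t).1) ≠ (S t).2).card

/-- Two sequences of examples are neighbours if they differ in at most one position. -/
def Neighbors {T : ℕ} {Z : Type u} (S S' : Fin T → Z) : Prop :=
  ∃ i, ∀ j, j ≠ i → S j = S' j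

/-- `(ε, δ)`-differential privacy of an online learner against an oblivious adversary, `M S` being
the distribution of the sequence of hypotheses released on the sequence `S` of examples. -/
def IsDP {T : ℕ} {Z : Type u} {H : Type v} [MeasurableSpace H] (ε δ : ℝ)
    (M : (Fin T → Z) → Measure (Fin T → H)) : Prop :=
  ∀ S S' : Fin T → Z, Neighbors S S' → ∀ R : Set (Fin T → H),
    M S R ≤ ENNReal.ofReal (Real.exp ε) * M S' R + ENNReal.ofReal δ

/-- The logarithm, truncated below at `1`, as is usual in asymptotic bounds. -/
def logOne (u : ℝ) : ℝ := max 1 (Real.log u)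

/-- `r^{6D} log³ N log^{5/2}(T/β) log²(1/δ) / ε⁴`. -/
def mainTerm (N T r D : ℕ) (ε δ β : ℝ) : ℝ :=
  (r : ℝ) ^ (6 * D) * logOne N ^ 3 * logOne (T / β) ^ (5 / 2 : ℝ) * logOne (1 / δ) ^ 2 / ε ^ 4

end DPWinnow

end

/-! Idea of the proof. A run is determined by its transcript: for each round, whether an update took
place and, if so, which samples were drawn. There are finitely many transcripts, and the probability
of each is a noise factor times a sample factor (`run_eq_sum`, `dpWinnow_apply`). Given the
transcript, the released vectors and the caches do not depend on the private weights, so the two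
factors can be compared separately.

Privacy. One changed example disturbs only the instance of AboveThreshold that is running when it
arrives. Raising the noisy threshold of that instance by one makes every "no update" at least as
likely, and the shift and the single update that ends the instance cost `exp (epsHat / 2)` each; the
number of updates does not enter (`noiseWeight_le_of_neighbors`). The private weights can separate
at one update only. They are then `4 * eta`-close up to normalization, and later updates multiply
both by the same factors, so the distance never grows (`Linked.update`). Each of the at most `K`
updates therefore multiplies the moments of the likelihood ratio of the samples by a bounded factor
(`sum_noiseWeight_mul_ratio_le`), and Markov's inequality turns this into an additive error
(`dpWinnow_le`).

Accuracy. A decision list is a halfspace with margin `g = 1 / (2 * r ^ D)` and nonnegative weights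
of total at most one (`exists_margin`). Outside an event of small probability, updates happen only
on nonempty caches, caches stay short, and the samples classify correctly every later example on
which the private weights have margin above `g / 2` (`sum_bad_transcripts_le`); the union bound over
examples is legitimate because the sequence is fixed in advance. So every cached example has private
margin at most `g / 2`, and each update lowers an entropy potential by `eta * g / 4`
(`potential_mwUpdate_le`). The potential starts at no more than the logarithm of the dimension, so
the budget `K` is never exhausted, and the errors number at most `K` times the cache bound plus one
(`errorCount_le`).

The parameters close the loop: `K` is of order `1 / eta` while the privacy exponent is of order `K *
eta ^ 2`, so a small learning rate suffices (`privacy_exponent_le`). -/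

namespace DPWinnow

/-! ### The Laplace distribution -/

section Laplace

variable {b : ℝ}

/-- The density of the Laplace distribution with scale `b`. -/
noncomputable def laplaceDensity (b x : ℝ) : ENNReal :=
  ENNReal.ofReal (Real.exp (-|x| / b) / (2 * b))

lemma measurable_laplaceDensity (b : ℝ) : Measurable (laplaceDensity b) := by
  unfold laplaceDensity; fun_prop

/-- The density is finite everywhere, so `f` may be arbitrary; the shift bound below inherits this
freedom. -/
lemma lintegral_laplace (b : ℝ) (f : ℝ → ENNReal) :
    ∫⁻ x, f x ∂laplace b = ∫⁻ x, laplaceDensity b x * f x := by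
  have h := lintegral_withDensity_eq_lintegral_mul_non_measurable volume
    (measurable_laplaceDensity b) (Filter.Eventually.of_forall fun x => ENNReal.ofReal_lt_top) f
  exact h

lemma lintegral_laplaceDensity (hb : 0 < b) : ∫⁻ x, laplaceDensity b x = 1 := by
  have hval : ∫ x in Set.Ioi (0 : ℝ), Real.exp (-x / b) / (2 * b) = 1 / 2 := by
    have h := integral_exp_mul_Ioi (a := -(1 / b)) (by simpa using hb) 0
    rw [integral_div]
    have e : (fun x : ℝ => Real.exp (-x / b)) = fun x => Real.exp (-(1 / b) * x) := by
      funext x; congr 1; ring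
    rw [e, h]
    simp
    field_simp
  have htot : ∫ x : ℝ, Real.exp (-|x| / b) / (2 * b) = 1 := by
    rw [integral_comp_abs (f := fun x : ℝ => Real.exp (-x / b) / (2 * b)), hval]
    norm_num
  -- A non-integrable function has Bochner integral `0`, so the value `1` already proves
  -- integrability.
  have hI : Integrable (fun x : ℝ => Real.exp (-|x| / b) / (2 * b)) := by
    by_contra h
    rw [integral_undef h] at htot
    exact zero_ne_one htot
  unfold laplaceDensity
  rw [← ofReal_integral_eq_lintegral_ofReal hI
    (Filter.Eventually.of_forall fun x => by positivity), htot, ENNReal.ofReal_one]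

lemma isProbabilityMeasure_laplace (hb : 0 < b) : IsProbabilityMeasure (laplace b) := by
  constructor
  have h := lintegral_laplace b fun _ => 1
  simpa [lintegral_laplaceDensity hb] using h

/-- By the triangle inequality, translating by `a` changes the density by a factor of at most `exp
(|a| / b)`; Lebesgue measure is translation invariant. All the privacy of the Laplace noise comes
from here. -/
lemma lintegral_laplace_add_le (hb : 0 < b) (a : ℝ) (f : ℝ → ENNReal) :
    ∫⁻ x, f (x + a) ∂laplace b ≤ ENNReal.ofReal (Real.exp (|a| / b)) * ∫⁻ x, f x ∂laplace b := by
  rw [lintegral_laplace, lintegral_laplace, ← lintegral_const_mul' _ _ ENNReal.ofReal_ne_top,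
    ← lintegral_add_right_eq_self
      (fun x => ENNReal.ofReal (Real.exp (|a| / b)) * (laplaceDensity b x * f x)) a]
  refine lintegral_mono fun x => ?_
  rw [← mul_assoc]
  gcongr
  unfold laplaceDensity
  rw [← ENNReal.ofReal_mul (by positivity), ← mul_div_assoc, ← Real.exp_add, ← add_div]
  gcongr
  have := abs_add_le x a
  linarith

lemma laplace_setOf_le_shift (hb : 0 < b) {x y a : ℝ} (ha : 0 ≤ a) (hxy : y ≤ x + a) :
    laplace b {ν | x ≤ ν} ≤ ENNReal.ofReal (Real.exp (a / b)) * laplace b {ν | y ≤ ν} := by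
  have h := lintegral_laplace_add_le hb a ({ν | y ≤ ν}.indicator 1)
  rw [lintegral_indicator_one (show MeasurableSet {ν | y ≤ ν} from measurableSet_Ici),
    abs_of_nonneg ha] at h
  refine le_trans ?_ h
  rw [← lintegral_indicator_one (show MeasurableSet {ν | x ≤ ν} from measurableSet_Ici)]
  refine lintegral_mono fun ν => ?_
  by_cases hν : x ≤ ν
  · have : y ≤ ν + a := by linarith
    simp [Set.indicator, hν, this]
  · simp [Set.indicator, hν]

/-- If translation by `a` brings every point of `s` closer to the origin by `x`, the density on `s`
is at most `exp (-x / b)` times a translated density, whose total mass is one. Both one-sided tails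
are instances. -/
lemma laplace_le_of_abs_add_le (hb : 0 < b) {s : Set ℝ} (hs : MeasurableSet s) {a x : ℝ}
    (h : ∀ v ∈ s, |v + a| + x ≤ |v|) : laplace b s ≤ ENNReal.ofReal (Real.exp (-x / b)) := by
  rw [← lintegral_indicator_one hs, lintegral_laplace]
  calc ∫⁻ v, laplaceDensity b v * s.indicator 1 v
      ≤ ∫⁻ v, ENNReal.ofReal (Real.exp (-x / b)) * laplaceDensity b (v + a) := by
        refine lintegral_mono fun v => ?_
        by_cases hv : v ∈ s
        · simp only [hv, Set.indicator_of_mem, Pi.one_apply, mul_one]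
          unfold laplaceDensity
          rw [← ENNReal.ofReal_mul (by positivity), ← mul_div_assoc, ← Real.exp_add, ← add_div]
          gcongr
          have := h v hv
          linarith
        · simp [hv]
    _ = _ := by
        rw [lintegral_const_mul' _ _ ENNReal.ofReal_ne_top,
          lintegral_add_right_eq_self (laplaceDensity b) a, lintegral_laplaceDensity hb, mul_one]

lemma laplace_upper_tail (hb : 0 < b) {x : ℝ} (hx : 0 ≤ x) :
    laplace b {ν | x ≤ ν} ≤ ENNReal.ofReal (Real.exp (-x / b)) := by
  refine laplace_le_of_abs_add_le hb measurableSet_Ici (a := -x) fun v hv => ?_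
  have hv : x ≤ v := hv
  rw [abs_of_nonneg (by linarith), abs_of_nonneg (by linarith)]
  linarith

lemma laplace_lower_tail (hb : 0 < b) {x : ℝ} (hx : 0 ≤ x) :
    laplace b {ν | ν ≤ -x} ≤ ENNReal.ofReal (Real.exp (-x / b)) := by
  refine laplace_le_of_abs_add_le hb measurableSet_Iic (a := x) fun v hv => ?_
  have hv : v ≤ -x := hv
  rw [abs_of_nonpos (by linarith), abs_of_nonpos (by linarith)]
  linarith

lemma laplace_abs_tail (hb : 0 < b) {x : ℝ} (hx : 0 ≤ x) :
    laplace b {ν | x < |ν|} ≤ 2 * ENNReal.ofReal (Real.exp (-x / b)) := by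
  rw [two_mul]
  refine le_trans (measure_mono fun ν hν => ?_) ((measure_union_le _ _).trans
    (add_le_add (laplace_upper_tail hb hx) (laplace_lower_tail hb hx)))
  have hν : x < |ν| := hν
  rcases lt_abs.1 hν with h | h
  · exact Or.inl h.le
  · refine Or.inr ?_
    change ν ≤ -x
    linarith

end Laplace

/-! ### Weight vectors -/

section Close

variable {ι : Type u}

/-- The ratios `w i / w' i` vary by a factor of at most `e ^ c`. -/
def Close (c : ℝ) (w w' : ι → ℝ) : Prop :=
  ∀ i j, w i * w' j ≤ Real.exp c * (w' i * w j)

/-- Reweighting by positive factors and rescaling. -/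
lemma Close.reweight {c e : ℝ} {w w' g g' : ι → ℝ} {Z Z' : ℝ} (h : Close c w w')
    (hw : ∀ i, 0 ≤ w i) (hw' : ∀ i, 0 ≤ w' i)
    (hZ : 0 < Z) (hZ' : 0 < Z') (hg : ∀ i, 0 ≤ g i) (hg' : ∀ i, 0 ≤ g' i)
    (hgg : ∀ i j, g i * g' j ≤ Real.exp e * (g' i * g j)) :
    Close (c + e) (fun i => w i * g i / Z) (fun i => w' i * g' i / Z') := by
  intro i j
  have := mul_le_mul (h i j) (hgg i j) (mul_nonneg (hg i) (hg' j))
    (mul_nonneg (Real.exp_pos c).le (mul_nonneg (hw' i) (hw j)))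
  rw [Real.exp_add]
  calc w i * g i / Z * (w' j * g' j / Z') = (w i * w' j * (g i * g' j)) / (Z * Z') := by
        field_simp
    _ ≤ (Real.exp c * (w' i * w j) * (Real.exp e * (g' i * g j))) / (Z * Z') := by gcongr
    _ = _ := by field_simp

lemma Close.refl {c : ℝ} (hc : 0 ≤ c) {w : ι → ℝ} (hw : ∀ i, 0 ≤ w i) : Close c w w := by
  intro i j
  have := mul_nonneg (hw i) (hw j)
  have h1 := Real.one_le_exp hc
  nlinarith

end Close

section Weights

variable {ι : Type u} [Fintype ι]

/-- A probability vector with positive entries. -/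
structure IsDist (w : ι → ℝ) : Prop where
  pos : ∀ j, 0 < w j
  sum_eq : ∑ j, w j = 1

/-- The signed inner product `y ⟨w, x⟩` of a weight vector with an example. -/
def margin (w : ι → ℝ) (z : Example ι) : ℝ := pm z.2 * ∑ j, w j * pm (z.1 j)

lemma pm_mul_self (b : Bool) : pm b * pm b = 1 := by cases b <;> simp [pm]

lemma abs_pm (b : Bool) : |pm b| = 1 := by cases b <;> simp [pm]

lemma margin_eq_sum (w : ι → ℝ) (z : Example ι) :
    margin w z = ∑ j, w j * (pm z.2 * pm (z.1 j)) := by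
  rw [margin, Finset.mul_sum]
  exact Finset.sum_congr rfl fun j _ => by ring

lemma halfspace_eq_of_margin_pos {w : ι → ℝ} {z : Example ι} (h : 0 < margin w z) :
    halfspace w z.1 = z.2 := by
  rw [margin] at h
  unfold halfspace sgn
  rcases hz : z.2 with _ | _
  · simp only [hz, pm, Bool.false_eq_true, if_false] at h
    simp only [decide_eq_false_iff_not, not_le]
    simp only [pm]
    linarith
  · simp only [hz, pm, if_true] at h
    simp only [decide_eq_true_eq]
    simp only [pm]
    linarith

/-- Uses `exp s ≤ 1 + s + s ^ 2` for `|s| ≤ 1`. It serves twice: as the Chernoff bound for the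
samples and as the bound on the normalizing constant of an update. -/
lemma IsDist.sum_mul_exp_le {w : ι → ℝ} (hw : IsDist w) {t : ℝ} (ht : |t| ≤ 1) (z : Example ι) :
    ∑ j, w j * Real.exp (t * (pm z.2 * pm (z.1 j))) ≤ Real.exp (t * margin w z + t ^ 2) := by
  have key : ∀ j, Real.exp (t * (pm z.2 * pm (z.1 j))) ≤
      1 + t * (pm z.2 * pm (z.1 j)) + t ^ 2 := by
    intro j
    have h1 : |t * (pm z.2 * pm (z.1 j))| = |t| := by
      rw [abs_mul, abs_mul, abs_pm, abs_pm]; ring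
    have h2 := Real.abs_exp_sub_one_sub_id_le (x := t * (pm z.2 * pm (z.1 j))) (by rwa [h1])
    rw [← sq_abs (t * _), h1, sq_abs] at h2
    have := le_of_abs_le h2
    linarith
  calc ∑ j, w j * Real.exp (t * (pm z.2 * pm (z.1 j)))
      ≤ ∑ j, w j * (1 + t * (pm z.2 * pm (z.1 j)) + t ^ 2) :=
        Finset.sum_le_sum fun j _ => mul_le_mul_of_nonneg_left (key j) (hw.pos j).le
    _ = (t * margin w z + t ^ 2) + 1 := by
        rw [margin_eq_sum, Finset.mul_sum]
        simp only [mul_add, Finset.sum_add_distrib, ← Finset.sum_mul, hw.sum_eq]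
        rw [Finset.sum_congr rfl fun j _ => mul_left_comm (w j) t _]
        ring
    _ ≤ _ := Real.add_one_le_exp _

lemma mwUpdate_eq (eta : ℝ) (w : ι → ℝ) (z : Example ι) (j : ι) :
    mwUpdate eta w z j = w j * Real.exp (eta * (pm z.2 * pm (z.1 j))) /
      ∑ i, w i * Real.exp (eta * (pm z.2 * pm (z.1 i))) := by
  unfold mwUpdate
  simp only [mul_assoc]
  ring

lemma IsDist.nonempty {w : ι → ℝ} (hw : IsDist w) : Nonempty ι := by
  by_contra h
  rw [not_nonempty_iff] at h
  simpa using hw.sum_eq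

lemma IsDist.sum_exp_pos {w : ι → ℝ} (hw : IsDist w) (f : ι → ℝ) :
    0 < ∑ i, w i * Real.exp (f i) := by
  have := hw.nonempty
  exact Finset.sum_pos (fun i _ => mul_pos (hw.pos i) (Real.exp_pos _)) Finset.univ_nonempty

lemma IsDist.mwUpdate {w : ι → ℝ} (hw : IsDist w) (eta : ℝ) (z : Example ι) :
    IsDist (mwUpdate eta w z) := by
  have hZ := hw.sum_exp_pos fun i => eta * (pm z.2 * pm (z.1 i))
  constructor
  · intro j
    rw [mwUpdate_eq]
    exact div_pos (mul_pos (hw.pos j) (Real.exp_pos _)) hZ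
  · simp only [mwUpdate_eq]
    rw [← Finset.sum_div, div_self hZ.ne']

lemma IsDist.updatedWeights {w : ι → ℝ} (hw : IsDist w) (eta : ℝ) (C : List (Example ι)) :
    IsDist (updatedWeights eta w C) := by
  unfold DPWinnow.updatedWeights
  cases C.head? with
  | none => exact hw
  | some z => exact hw.mwUpdate eta z

lemma IsDist.le_one {w : ι → ℝ} (hw : IsDist w) (j : ι) : w j ≤ 1 := by
  rw [← hw.sum_eq]
  exact Finset.single_le_sum (fun i _ => (hw.pos i).le) (Finset.mem_univ j)

lemma isDist_uniform [Nonempty ι] : IsDist fun _ : ι => 1 / (Fintype.card ι : ℝ) := by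
  have : (0 : ℝ) < Fintype.card ι := by exact_mod_cast Fintype.card_pos
  constructor
  · intro _; positivity
  · simp [this.ne']

lemma IsDist.sum_prod {w : ι → ℝ} (hw : IsDist w) (m : ℕ) :
    ∑ J : Fin m → ι, ENNReal.ofReal (∏ i, w (J i)) = 1 := by
  rw [← ENNReal.ofReal_sum_of_nonneg fun J _ => Finset.prod_nonneg fun i _ => (hw.pos _).le]
  rw [← Fintype.sum_pow w m, hw.sum_eq]
  simp

/-- `Close` is invariant under rescaling either vector; for vectors of total mass one, summing over
`j` removes the second index and leaves a pointwise ratio bound. -/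
lemma Close.le {c : ℝ} {w w' : ι → ℝ} (h : Close c w w') (hw : IsDist w) (hw' : IsDist w')
    (i : ι) : w i ≤ Real.exp c * w' i := by
  have := Finset.sum_le_sum fun j (_ : j ∈ Finset.univ) => h i j
  simpa only [← Finset.mul_sum, hw.sum_eq, hw'.sum_eq, mul_one] using this

lemma Close.ge {c : ℝ} {w w' : ι → ℝ} (h : Close c w w') (hw : IsDist w) (hw' : IsDist w')
    (j : ι) : w' j ≤ Real.exp c * w j := by
  have := Finset.sum_le_sum fun i (_ : i ∈ Finset.univ) => h i j
  simpa only [← Finset.mul_sum, ← Finset.sum_mul, hw.sum_eq, hw'.sum_eq, mul_one, one_mul]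
    using this

/-- With a common cache both vectors are multiplied by the same factors, and `Close` does not see
the normalizing constants. Hence the loss does not accumulate over updates. -/
lemma Close.updatedWeights {c : ℝ} {w w' : ι → ℝ} (h : Close c w w') (hw : IsDist w)
    (hw' : IsDist w') (eta : ℝ) (C : List (Example ι)) :
    Close c (updatedWeights eta w C) (updatedWeights eta w' C) := by
  unfold DPWinnow.updatedWeights
  cases C.head? with
  | none => exact h
  | some z =>
    have := h.reweight (e := 0) (fun i => (hw.pos i).le) (fun i => (hw'.pos i).le)
      (hw.sum_exp_pos fun i => eta * (pm z.2 * pm (z.1 i)))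
      (hw'.sum_exp_pos fun i => eta * (pm z.2 * pm (z.1 i)))
      (g := fun j => Real.exp (eta * (pm z.2 * pm (z.1 j))))
      (g' := fun j => Real.exp (eta * (pm z.2 * pm (z.1 j))))
      (fun i => (Real.exp_pos _).le) (fun i => (Real.exp_pos _).le) (fun i j => by simp)
    rw [add_zero] at this
    intro i j
    simp only [mwUpdate_eq]
    exact this i j

/-- Any multiplicative weights update is of the form `w j * exp (eta * s j) / Z`, `|s j| ≤ 1`. -/
lemma exists_updatedWeights_eq {w : ι → ℝ} (hw : IsDist w) (eta : ℝ) (C : List (Example ι)) :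
    ∃ (s : ι → ℝ) (Z : ℝ), 0 < Z ∧ (∀ j, |s j| ≤ 1) ∧
      updatedWeights eta w C = fun j => w j * Real.exp (eta * s j) / Z := by
  unfold DPWinnow.updatedWeights
  cases C.head? with
  | none => exact ⟨0, 1, one_pos, by simp, by simp⟩
  | some z =>
    refine ⟨fun j => pm z.2 * pm (z.1 j), _,
      hw.sum_exp_pos fun i => eta * (pm z.2 * pm (z.1 i)), fun j => ?_, ?_⟩
    · rw [abs_mul, abs_pm, abs_pm, one_mul]
    · funext j; exact mwUpdate_eq eta w z j

/-- The worst case for the caches, one of which may be empty: four exponents of size at most `eta`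
enter the cross ratio, whence `4 * eta`. -/
lemma close_updatedWeights {w : ι → ℝ} (hw : IsDist w) {eta : ℝ} (he : 0 ≤ eta)
    (C C' : List (Example ι)) :
    Close (4 * eta) (updatedWeights eta w C) (updatedWeights eta w C') := by
  obtain ⟨s, Z, hZ, hs, h⟩ := exists_updatedWeights_eq hw eta C
  obtain ⟨s', Z', hZ', hs', h'⟩ := exists_updatedWeights_eq hw eta C'
  rw [h, h']
  have := (Close.refl le_rfl fun i => (hw.pos i).le).reweight (e := 4 * eta)
      (fun i => (hw.pos i).le) (fun i => (hw.pos i).le) hZ hZ'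
      (g := fun j => Real.exp (eta * s j)) (g' := fun j => Real.exp (eta * s' j))
      (fun i => (Real.exp_pos _).le) (fun i => (Real.exp_pos _).le) (fun i j => by
        rw [← Real.exp_add, ← Real.exp_add, ← Real.exp_add]
        refine Real.exp_le_exp.2 ?_
        have h1 := abs_le.1 (hs i)
        have h2 := abs_le.1 (hs j)
        have h3 := abs_le.1 (hs' i)
        have h4 := abs_le.1 (hs' j)
        nlinarith)
  rwa [zero_add] at this

/-- The Rényi-type moment bound for two close probability vectors. -/
lemma Close.sum_mul_rpow_le {c l : ℝ} {w w' : ι → ℝ} (h : Close c w w') (hw : IsDist w)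
    (hw' : IsDist w') (hc : 0 < c) (hl : 0 ≤ l) :
    ∑ j, w j * (w j / w' j) ^ l ≤ Real.exp ((l + 1) ^ 2 * c ^ 2 / 2) := by
  set x := (l + 1) * c with hx
  have hx0 : 0 ≤ x := by positivity
  have hq : ∀ j, 0 < w j / w' j := fun j => div_pos (hw.pos j) (hw'.pos j)
  have hlog : ∀ j, |Real.log (w j / w' j) / c| ≤ 1 := by
    intro j
    rw [abs_div, abs_of_pos hc, div_le_one hc, abs_le]
    constructor
    · rw [Real.le_log_iff_exp_le (hq j), Real.exp_neg, le_div_iff₀ (hw'.pos j)]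
      rw [inv_mul_le_iff₀ (Real.exp_pos c)]
      exact h.ge hw hw' j
    · rw [Real.log_le_iff_le_exp (hq j), div_le_iff₀ (hw'.pos j)]
      exact h.le hw hw' j
  -- The left side is `w' j * exp (y * x)` with `y` the normalized log-ratio in `[-1, 1]`; convexity
  -- of the exponential bounds it by the chord.
  have key : ∀ j, w j * (w j / w' j) ^ l ≤
      w' j * (Real.cosh x + Real.log (w j / w' j) / c * Real.sinh x) := by
    intro j
    have h1 := Real.exp_mul_le_cosh_add_mul_sinh (hlog j) x
    have h2 : w j * (w j / w' j) ^ l = w' j * Real.exp (Real.log (w j / w' j) / c * x) := by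
      have e : Real.log (w j / w' j) / c * x =
          Real.log (w j / w' j) + Real.log (w j / w' j) * l := by
        rw [hx]; field_simp; ring
      rw [e, Real.exp_add, Real.exp_log (hq j), Real.rpow_def_of_pos (hq j)]
      have := (hw'.pos j).ne'
      field_simp
    rw [h2]
    exact mul_le_mul_of_nonneg_left h1 (hw'.pos j).le
  -- This is minus the relative entropy of `w'` with respect to `w`. Its sign removes the `sinh`
  -- term, which makes the exponent quadratic in `c` rather than linear.
  have hmean : ∑ j, w' j * Real.log (w j / w' j) ≤ 0 := by
    calc ∑ j, w' j * Real.log (w j / w' j) ≤ ∑ j, w' j * (w j / w' j - 1) :=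
          Finset.sum_le_sum fun j _ => mul_le_mul_of_nonneg_left
            (Real.log_le_sub_one_of_pos (hq j)) (hw'.pos j).le
      _ = ∑ j, (w j - w' j) := Finset.sum_congr rfl fun j _ => by
          have := (hw'.pos j).ne'
          field_simp
      _ = 0 := by rw [Finset.sum_sub_distrib, hw.sum_eq, hw'.sum_eq, sub_self]
  calc ∑ j, w j * (w j / w' j) ^ l
      ≤ ∑ j, w' j * (Real.cosh x + Real.log (w j / w' j) / c * Real.sinh x) :=
        Finset.sum_le_sum fun j _ => key j
    _ = Real.cosh x + Real.sinh x / c * ∑ j, w' j * Real.log (w j / w' j) := by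
        simp only [mul_add, Finset.sum_add_distrib, ← Finset.sum_mul, hw'.sum_eq, one_mul]
        rw [Finset.mul_sum]
        congr 1
        exact Finset.sum_congr rfl fun j _ => by ring
    _ ≤ Real.cosh x := by
        have : 0 ≤ Real.sinh x / c := div_nonneg (Real.sinh_nonneg_iff.2 hx0) hc.le
        nlinarith
    _ ≤ Real.exp (x ^ 2 / 2) := Real.cosh_le_exp_half_sq x
    _ = _ := by rw [hx, mul_pow]

end Weights

/-! ### Transcripts

A transcript records, for each round, whether an update took place and which samples were drawn.
It determines the released weight vectors, the caches and the private weights. -/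

section Transcripts

variable {ι : Type u}

/-- The internal state without the noisy threshold. -/
structure Core (ι : Type u) where
  w : ι → ℝ
  wt : ι → ℝ
  C : List (Example ι)
  k : ℕ

/-- Complete a state by a noisy threshold. -/
def Core.withThr (c : Core ι) (θ : ℝ) : State ι := ⟨c.w, c.wt, c.C, c.k, θ⟩

/-- The released weight vectors. -/
noncomputable def released {m : ℕ} : (T : ℕ) → (ι → ℝ) → (Fin T → Option (Fin m → ι)) →
    Fin T → ι → ℝ
  | 0, _, _ => Fin.elim0
  | T + 1, wt, τ => Fin.cons wt (released T
      (match τ 0 with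
        | none => wt
        | some J => empirical J) (Fin.tail τ))

lemma measurable_cons {T : ℕ} (x : ι → ℝ) :
    Measurable (Fin.cons (n := T) (α := fun _ => ι → ℝ) x) := by
  refine measurable_pi_lambda _ fun i => ?_
  cases i using Fin.cases with
  | zero => simp
  | succ i => simpa using measurable_pi_apply i

variable [Fintype ι]

/-- The cache after the example `z` has been processed. -/
noncomputable def Core.push (c : Core ι) (z : Example ι) : List (Example ι) :=
  if halfspace c.wt z.1 ≠ z.2 then c.C ++ [z] else c.C

/-- The next state if no update takes place. -/
noncomputable def Core.skip (c : Core ι) (z : Example ι) : Core ι := { c with C := c.push z }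

/-- The next state after an update with samples `J`. -/
noncomputable def Core.update (p : Params) (c : Core ι) (z : Example ι) (J : Fin p.m → ι) :
    Core ι where
  w := updatedWeights p.eta c.w (c.push z)
  wt := empirical J
  C := []
  k := c.k + 1

/-- The noise values for which an update takes place. -/
def updateSet (p : Params) (c : Core ι) (z : Example ι) (θ : ℝ) : Set ℝ :=
  {ν | θ ≤ ((c.push z).length : ℝ) + ν ∧ c.k < p.K}

/-- The probability of an update. -/
noncomputable def updateProb (p : Params) (c : Core ι) (z : Example ι) (θ : ℝ) : ENNReal :=
  laplace (4 / p.epsHat) (updateSet p c z θ)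

/-- The probability that no update takes place. -/
noncomputable def skipProb (p : Params) (c : Core ι) (z : Example ι) (θ : ℝ) : ENNReal :=
  laplace (4 / p.epsHat) (updateSet p c z θ)ᶜ

/-- The contribution of AboveThreshold to the probability of a transcript. -/
noncomputable def noiseWeight (p : Params) : (T : ℕ) → (Fin T → Example ι) → Core ι → ℝ →
    (Fin T → Option (Fin p.m → ι)) → ENNReal
  | 0, _, _, _, _ => 1
  | T + 1, S, c, θ, τ =>
    match τ 0 with
    | none => skipProb p c (S 0) θ * noiseWeight p T (Fin.tail S) (c.skip (S 0)) θ (Fin.tail τ)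
    | some J => updateProb p c (S 0) θ *
        ∫⁻ ξ, noiseWeight p T (Fin.tail S) (c.update p (S 0) J) (p.L + ξ) (Fin.tail τ)
          ∂laplace (2 / p.epsHat)

/-- The contribution of the samples to the probability of a transcript. -/
noncomputable def sampleWeight (p : Params) : (T : ℕ) → (Fin T → Example ι) → Core ι →
    (Fin T → Option (Fin p.m → ι)) → ℝ
  | 0, _, _, _ => 1
  | T + 1, S, c, τ =>
    match τ 0 with
    | none => sampleWeight p T (Fin.tail S) (c.skip (S 0)) (Fin.tail τ)
    | some J => (∏ i, updatedWeights p.eta c.w (c.push (S 0)) (J i)) *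
        sampleWeight p T (Fin.tail S) (c.update p (S 0) J) (Fin.tail τ)

section Cons

variable (p : Params) {T : ℕ} (S : Fin (T + 1) → Example ι) (c : Core ι) (θ : ℝ)
  (J : Fin p.m → ι) (τ : Fin T → Option (Fin p.m → ι))

lemma noiseWeight_cons_none :
    noiseWeight p (T + 1) S c θ (Fin.cons (α := fun _ => Option (Fin p.m → ι)) none τ) =
      skipProb p c (S 0) θ * noiseWeight p T (Fin.tail S) (c.skip (S 0)) θ τ := rfl

lemma noiseWeight_cons_some :
    noiseWeight p (T + 1) S c θ (Fin.cons (α := fun _ => Option (Fin p.m → ι)) (some J) τ) =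
      updateProb p c (S 0) θ *
        ∫⁻ ξ, noiseWeight p T (Fin.tail S) (c.update p (S 0) J) (p.L + ξ) τ
          ∂laplace (2 / p.epsHat) := rfl

lemma sampleWeight_cons_none :
    sampleWeight p (T + 1) S c (Fin.cons (α := fun _ => Option (Fin p.m → ι)) none τ) =
      sampleWeight p T (Fin.tail S) (c.skip (S 0)) τ := rfl

lemma sampleWeight_cons_some :
    sampleWeight p (T + 1) S c (Fin.cons (α := fun _ => Option (Fin p.m → ι)) (some J) τ) =
      (∏ i, updatedWeights p.eta c.w (c.push (S 0)) (J i)) *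
        sampleWeight p T (Fin.tail S) (c.update p (S 0) J) τ := rfl

end Cons

lemma transcript_cases {α : Type*} {T : ℕ} {P : (Fin (T + 1) → Option α) → Prop}
    (h0 : ∀ τ : Fin T → Option α, P (Fin.cons (α := fun _ => Option α) none τ))
    (h1 : ∀ (J : α) (τ : Fin T → Option α), P (Fin.cons (α := fun _ => Option α) (some J) τ))
    (τ : Fin (T + 1) → Option α) : P τ := by
  rw [← Fin.cons_self_tail τ]
  cases τ 0 with
  | none => exact h0 _
  | some J => exact h1 J _

lemma sum_transcript {α M : Type*} [Fintype α] [AddCommMonoid M] {T : ℕ}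
    (f : (Fin (T + 1) → Option α) → M) :
    ∑ τ, f τ = (∑ τ : Fin T → Option α, f (Fin.cons (α := fun _ => Option α) none τ)) +
      ∑ J : α, ∑ τ : Fin T → Option α, f (Fin.cons (α := fun _ => Option α) (some J) τ) := by
  rw [← (Fin.consEquiv fun _ : Fin (T + 1) => Option α).sum_comp, Fintype.sum_prod_type,
    Fintype.sum_option]
  rfl

lemma sampleWeight_pos (p : Params) : ∀ (T : ℕ) (S : Fin T → Example ι) (c : Core ι)
    (_ : IsDist c.w) (τ : Fin T → Option (Fin p.m → ι)), 0 < sampleWeight p T S c τ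
  | 0, _, _, _, _ => one_pos
  | T + 1, S, c, hc, τ => by
    induction τ using transcript_cases with
    | h0 τ => exact sampleWeight_pos p T _ (c.skip (S 0)) hc τ
    | h1 J τ =>
      have hw := hc.updatedWeights p.eta (c.push (S 0))
      exact mul_pos (Finset.prod_pos fun i _ => hw.pos _) (sampleWeight_pos p T _ _ hw τ)

lemma laplace_four_prob (p : Params) : IsProbabilityMeasure (laplace (4 / p.epsHat)) :=
  isProbabilityMeasure_laplace (div_pos (by norm_num) p.epsHat_pos)

lemma laplace_two_prob (p : Params) : IsProbabilityMeasure (laplace (2 / p.epsHat)) :=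
  isProbabilityMeasure_laplace (div_pos (by norm_num) p.epsHat_pos)

lemma measurableSet_updateSet (p : Params) (c : Core ι) (z : Example ι) (θ : ℝ) :
    MeasurableSet (updateSet p c z θ) := by
  exact (measurableSet_le measurable_const (measurable_const.add measurable_id)).inter (MeasurableSet.const _)

lemma skipProb_add_updateProb (p : Params) (c : Core ι) (z : Example ι) (θ : ℝ) :
    skipProb p c z θ + updateProb p c z θ = 1 := by
  have := laplace_four_prob p
  rw [add_comm]
  exact prob_add_prob_compl (measurableSet_updateSet p c z θ)

lemma skipProb_mono (p : Params) (c : Core ι) (z : Example ι) : Monotone (skipProb p c z) := by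
  intro θ θ' h
  refine measure_mono fun ν hν hν' => hν ⟨h.trans hν'.1, hν'.2⟩

lemma updateProb_anti (p : Params) (c : Core ι) (z : Example ι) :
    Antitone (updateProb p c z) := by
  intro θ θ' h
  exact measure_mono fun ν hν => ⟨h.trans hν.1, hν.2⟩

/-- A skip probability is monotone in the threshold and an update probability antitone; after an
update the threshold is redrawn, so the remaining factor is constant in `θ`. -/
lemma measurable_noiseWeight (p : Params) : ∀ (T : ℕ) (S : Fin T → Example ι) (c : Core ι)
    (τ : Fin T → Option (Fin p.m → ι)), Measurable fun θ => noiseWeight p T S c θ τ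
  | 0, _, _, _ => measurable_const
  | T + 1, S, c, τ => by
    induction τ using transcript_cases with
    | h0 τ =>
      exact (skipProb_mono p c (S 0)).measurable.mul (measurable_noiseWeight p T _ _ τ)
    | h1 J τ => exact (updateProb_anti p c (S 0)).measurable.mul_const _

/-! ### The output law as a finite mixture of point masses. -/

lemma bind_ite {α β : Type*} [MeasurableSpace α] [MeasurableSpace β] (μ : Measure α)
    {P : α → Prop} [DecidablePred P] (hP : MeasurableSet {a | P a}) (A B : Measure β) :
    (μ.bind fun a => if P a then A else B) = μ {a | P a} • A + μ {a | P a}ᶜ • B := by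
  ext s hs
  have hm : Measurable fun a => if P a then A else B :=
    Measurable.ite hP measurable_const measurable_const
  rw [Measure.bind_apply hs hm.aemeasurable]
  have : (fun a => (if P a then A else B) s) =
      fun a => {a | P a}.indicator (fun _ => A s) a + {a | P a}ᶜ.indicator (fun _ => B s) a := by
    funext a
    by_cases h : P a <;> simp [h]
  rw [this, lintegral_add_left (measurable_const.indicator hP), lintegral_indicator hP,
    lintegral_indicator hP.compl]
  simp [mul_comm]

lemma bind_sum_smul {α β κ : Type*} [MeasurableSpace α] [MeasurableSpace β] [Fintype κ]
    (μ : Measure α) (f : κ → α → ENNReal) (hf : ∀ i, Measurable (f i)) (A : κ → Measure β) :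
    (μ.bind fun a => ∑ i, f i a • A i) = ∑ i, (∫⁻ a, f i a ∂μ) • A i := by
  ext s hs
  have hm : Measurable fun a => ∑ i, f i a • A i := by
    refine Measure.measurable_of_measurable_coe _ fun t ht => ?_
    simp only [Measure.coe_finsetSum, Finset.sum_apply, Measure.smul_apply, smul_eq_mul]
    exact Finset.measurable_sum _ fun i _ => (hf i).mul_const _
  rw [Measure.bind_apply hs hm.aemeasurable]
  simp only [Measure.coe_finsetSum, Finset.sum_apply, Measure.smul_apply, smul_eq_mul]
  rw [lintegral_finsetSum _ fun i _ => (hf i).mul_const _]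
  exact Finset.sum_congr rfl fun i _ => lintegral_mul_const _ (hf i)

lemma map_sum_smul_dirac {α β κ : Type*} [MeasurableSpace α] [MeasurableSpace β] [Fintype κ]
    (a : κ → ENNReal) (x : κ → α) {g : α → β} (hg : Measurable g) :
    (∑ i, a i • Measure.dirac (x i)).map g = ∑ i, a i • Measure.dirac (g (x i)) := by
  rw [← Measure.mapₗ_apply_of_measurable hg, map_sum]
  refine Finset.sum_congr rfl fun i _ => ?_
  rw [Measure.mapₗ_apply_of_measurable hg, Measure.map_smul, Measure.map_dirac' hg]

/-- The law of the released weight vectors as a mixture over transcripts. -/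
lemma run_eq_sum (p : Params) : ∀ (T : ℕ) (S : Fin T → Example ι) (c : Core ι) (_ : IsDist c.w)
    (θ : ℝ), run p T S (c.withThr θ) = ∑ τ : Fin T → Option (Fin p.m → ι),
      (noiseWeight p T S c θ τ * ENNReal.ofReal (sampleWeight p T S c τ)) •
        Measure.dirac (released T c.wt τ)
  | 0, S, c, _, θ => by
    simp [run, noiseWeight, sampleWeight, released]
  | T + 1, S, c, hc, θ => by
    have hw := hc.updatedWeights p.eta (c.push (S 0))
    have hskip : (run p T (Fin.tail S) ((c.skip (S 0)).withThr θ)).map (Fin.cons c.wt) =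
        ∑ τ : Fin T → Option (Fin p.m → ι), (noiseWeight p T (Fin.tail S) (c.skip (S 0)) θ τ *
          ENNReal.ofReal (sampleWeight p T (Fin.tail S) (c.skip (S 0)) τ)) •
            Measure.dirac (released (T + 1) c.wt
              (Fin.cons (α := fun _ => Option (Fin p.m → ι)) none τ)) := by
      rw [run_eq_sum p T _ _ (by exact hc), map_sum_smul_dirac _ _ (measurable_cons _)]
      rfl
    have hupd : ∀ J : Fin p.m → ι, ((laplace (2 / p.epsHat)).bind fun ξ =>
        (run p T (Fin.tail S) ((c.update p (S 0) J).withThr (p.L + ξ))).map (Fin.cons c.wt)) =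
        ∑ τ : Fin T → Option (Fin p.m → ι),
          (∫⁻ ξ, noiseWeight p T (Fin.tail S) (c.update p (S 0) J) (p.L + ξ) τ *
            ENNReal.ofReal (sampleWeight p T (Fin.tail S) (c.update p (S 0) J) τ)
            ∂laplace (2 / p.epsHat)) •
            Measure.dirac (released (T + 1) c.wt
              (Fin.cons (α := fun _ => Option (Fin p.m → ι)) (some J) τ)) := by
      intro J
      refine Eq.trans (congrArg (Measure.bind _) (funext fun ξ => ?_)) (bind_sum_smul _
        (fun τ ξ => noiseWeight p T (Fin.tail S) (c.update p (S 0) J) (p.L + ξ) τ *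
            ENNReal.ofReal (sampleWeight p T (Fin.tail S) (c.update p (S 0) J) τ))
        (fun τ => ((measurable_noiseWeight p T (Fin.tail S)
          (c.update p (S 0) J) τ).comp (measurable_const_add p.L)).mul_const _) _)
      rw [run_eq_sum p T _ _ (by exact hw), map_sum_smul_dirac _ _ (measurable_cons _)]
      rfl
    have hrun : run p (T + 1) S (c.withThr θ) = updateProb p c (S 0) θ •
        (∑ J : Fin p.m → ι,
          ENNReal.ofReal (∏ i, updatedWeights p.eta c.w (c.push (S 0)) (J i)) •
          ((laplace (2 / p.epsHat)).bind fun ξ =>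
            (run p T (Fin.tail S) ((c.update p (S 0) J).withThr (p.L + ξ))).map
              (Fin.cons c.wt))) +
        skipProb p c (S 0) θ •
          (run p T (Fin.tail S) ((c.skip (S 0)).withThr θ)).map (Fin.cons c.wt) := by
      refine Eq.trans ?_ (bind_ite _ (measurableSet_updateSet p c (S 0) θ) _ _)
      rfl
    rw [hrun, hskip, sum_transcript, add_comm (updateProb p c (S 0) θ • _), Finset.smul_sum, Finset.smul_sum]
    congr 1
    · refine Finset.sum_congr rfl fun τ _ => ?_
      rw [smul_smul, noiseWeight_cons_none, sampleWeight_cons_none, mul_assoc]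
    · refine Finset.sum_congr rfl fun J _ => ?_
      rw [hupd, Finset.smul_sum, Finset.smul_sum]
      refine Finset.sum_congr rfl fun τ _ => ?_
      rw [smul_smul, smul_smul, noiseWeight_cons_some, sampleWeight_cons_some,
        lintegral_mul_const' _ _ ENNReal.ofReal_ne_top,
        ENNReal.ofReal_mul (Finset.prod_nonneg fun i _ => (hw.pos _).le)]
      congr 1
      ring

lemma sum_lintegral_noiseWeight_mul (p : Params) {T : ℕ} (S : Fin T → Example ι) (c : Core ι)
    (a : (Fin T → Option (Fin p.m → ι)) → ENNReal) :
    ∑ τ, (∫⁻ ξ, noiseWeight p T S c (p.L + ξ) τ ∂laplace (2 / p.epsHat)) * a τ =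
      ∫⁻ ξ, ∑ τ, noiseWeight p T S c (p.L + ξ) τ * a τ ∂laplace (2 / p.epsHat) := by
  have hm : ∀ τ, Measurable fun ξ => noiseWeight p T S c (p.L + ξ) τ := fun τ =>
    (measurable_noiseWeight p T S c τ).comp (measurable_const_add p.L)
  rw [lintegral_finsetSum _ fun τ _ => (hm τ).mul_const _]
  exact Finset.sum_congr rfl fun τ _ => (lintegral_mul_const _ (hm τ)).symm

/-- The initial state. -/
noncomputable def initCore (ι : Type u) [Fintype ι] : Core ι where
  w := fun _ => 1 / (Fintype.card ι : ℝ)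
  wt := fun _ => 1 / (Fintype.card ι : ℝ)
  C := []
  k := 0

/-- The total contribution of AboveThreshold to the probability of a transcript. -/
noncomputable def initNoise (p : Params) {T : ℕ} (S : Fin T → Example ι)
    (τ : Fin T → Option (Fin p.m → ι)) : ENNReal :=
  ∫⁻ ξ, noiseWeight p T S (initCore ι) (p.L + ξ) τ ∂laplace (2 / p.epsHat)

/-- A finite mixture of point masses can be evaluated on any set, measurable or not, as the
definition of privacy demands. -/
lemma dpWinnow_apply [Nonempty ι] (p : Params) {T : ℕ} (S : Fin T → Example ι)
    (R : Set (Fin T → ι → ℝ)) :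
    dpWinnow p S R = ∑ τ : Fin T → Option (Fin p.m → ι),
      initNoise p S τ * ENNReal.ofReal (sampleWeight p T S (initCore ι) τ) *
        R.indicator 1 (released T (initCore ι).wt τ) := by
  have h : dpWinnow p S = ∑ τ : Fin T → Option (Fin p.m → ι),
      (∫⁻ ξ, noiseWeight p T S (initCore ι) (p.L + ξ) τ *
        ENNReal.ofReal (sampleWeight p T S (initCore ι) τ) ∂laplace (2 / p.epsHat)) •
        Measure.dirac (released T (initCore ι).wt τ) := by
    refine Eq.trans (congrArg (Measure.bind _) (funext fun ξ => ?_)) (bind_sum_smul _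
      (fun τ ξ => noiseWeight p T S (initCore ι) (p.L + ξ) τ *
        ENNReal.ofReal (sampleWeight p T S (initCore ι) τ))
      (fun τ => ((measurable_noiseWeight p T S
        (initCore ι) τ).comp (measurable_const_add p.L)).mul_const _) _)
    exact run_eq_sum p T S (initCore ι) isDist_uniform _
  rw [h]
  simp only [Measure.coe_finsetSum, Finset.sum_apply, Measure.smul_apply, smul_eq_mul,
    Measure.dirac_apply, lintegral_mul_const' _ _ ENNReal.ofReal_ne_top]
  rfl

end Transcripts

/-! ### Privacy -/

section Privacy

lemma Neighbors.cases {Z : Type u} {T : ℕ} {S S' : Fin (T + 1) → Z} (h : Neighbors S S') :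
    Fin.tail S = Fin.tail S' ∨ (S 0 = S' 0 ∧ Neighbors (Fin.tail S) (Fin.tail S')) := by
  obtain ⟨i, hi⟩ := h
  cases i using Fin.cases with
  | zero => exact Or.inl (funext fun j => hi _ (Fin.succ_ne_zero j))
  | succ i =>
    exact Or.inr ⟨hi 0 (Fin.succ_ne_zero i).symm, i, fun j hj =>
      hi _ fun h => hj (Fin.succ_injective _ h)⟩

variable {ι : Type u} [Fintype ι] (p : Params)

/-! ### AboveThreshold on neighbouring sequences. -/

lemma Core.push_length_le (c : Core ι) (z : Example ι) :
    (c.push z).length ≤ c.C.length + 1 := by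
  unfold Core.push; split_ifs <;> simp

lemma Core.le_push_length (c : Core ι) (z : Example ι) :
    c.C.length ≤ (c.push z).length := by
  unfold Core.push; split_ifs <;> simp

lemma push_congr {c c' : Core ι} (hwt : c.wt = c'.wt) (hC : c.C = c'.C) (z : Example ι) :
    c.push z = c'.push z := by
  unfold Core.push; rw [hwt, hC]

lemma updateSet_congr {c c' : Core ι} {z z' : Example ι} (hk : c.k = c'.k)
    (h : (c.push z).length = (c'.push z').length) (θ : ℝ) :
    updateSet p c z θ = updateSet p c' z' θ := by
  unfold updateSet; rw [hk, h]

lemma skipProb_le {c c' : Core ι} {z z' : Example ι} (hk : c.k = c'.k)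
    (h : (c'.push z').length ≤ (c.push z).length + 1) (θ : ℝ) :
    skipProb p c z θ ≤ skipProb p c' z' (θ + 1) := by
  refine measure_mono fun ν hν hν' => hν ⟨?_, hk ▸ hν'.2⟩
  have h1 := hν'.1
  have h2 : ((c'.push z').length : ℝ) ≤ (c.push z).length + 1 := by exact_mod_cast h
  linarith

/-- The threshold moves by one and the query by at most one, so the cutoff for the noise moves by at
most `2`; at scale `4 / epsHat` this costs `exp (epsHat / 2)`. -/
lemma updateProb_le {c c' : Core ι} {z z' : Example ι} (hk : c.k = c'.k)
    (h : (c.push z).length ≤ (c'.push z').length + 1) (θ : ℝ) :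
    updateProb p c z θ ≤ ENNReal.ofReal (Real.exp (p.epsHat / 2)) *
      updateProb p c' z' (θ + 1) := by
  have h2 : ((c.push z).length : ℝ) ≤ (c'.push z').length + 1 := by exact_mod_cast h
  have hε := p.epsHat_pos
  unfold updateProb
  by_cases hK : c.k < p.K
  · have e1 : updateSet p c z θ = {ν | θ - (c.push z).length ≤ ν} := by
      ext ν; simp [updateSet, hK, add_comm]
    have e2 : updateSet p c' z' (θ + 1) = {ν | θ + 1 - (c'.push z').length ≤ ν} := by
      ext ν; simp [updateSet, ← hk, hK, add_comm]
    rw [e1, e2]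
    have h3 := laplace_setOf_le_shift (b := 4 / p.epsHat) (by positivity)
      (x := θ - (c.push z).length) (y := θ + 1 - (c'.push z').length) (a := 2) (by norm_num)
      (by linarith)
    rwa [show (2 : ℝ) / (4 / p.epsHat) = p.epsHat / 2 by field_simp; norm_num] at h3
  · have e1 : updateSet p c z θ = ∅ := by
      ext ν; simp [updateSet, hK]
    simp [e1]

/-- The private weights influence AboveThreshold only through the samples, and those are recorded in
the transcript. -/
lemma noiseWeight_congr : ∀ (T : ℕ) (S : Fin T → Example ι) (c c' : Core ι) (θ : ℝ)
    (τ : Fin T → Option (Fin p.m → ι)), c.wt = c'.wt → c.C = c'.C → c.k = c'.k →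
    noiseWeight p T S c θ τ = noiseWeight p T S c' θ τ
  | 0, _, _, _, _, _, _, _, _ => rfl
  | T + 1, S, c, c', θ, τ, hwt, hC, hk => by
    have hp := push_congr hwt hC (S 0)
    have hs := updateSet_congr p hk (congrArg List.length hp) θ
    induction τ using transcript_cases with
    | h0 τ =>
      rw [noiseWeight_cons_none, noiseWeight_cons_none, skipProb, skipProb, hs,
        noiseWeight_congr T _ (c.skip (S 0)) (c'.skip (S 0)) θ τ hwt hp hk]
    | h1 J τ =>
      rw [noiseWeight_cons_some, noiseWeight_cons_some, updateProb, updateProb, hs]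
      congr 1
      refine lintegral_congr fun ξ => ?_
      exact noiseWeight_congr T _ _ _ _ τ rfl rfl (congrArg (· + 1) hk)

/-- The examples now agree and only the cache lengths may differ. Skips are free after raising the
threshold by one; the next update is paid for once and empties both caches, after which the two
noise weights coincide. -/
lemma noiseWeight_le_of_length : ∀ (T : ℕ) (S : Fin T → Example ι) (c c' : Core ι) (θ : ℝ)
    (τ : Fin T → Option (Fin p.m → ι)), c.wt = c'.wt → c.k = c'.k →
    c.C.length ≤ c'.C.length + 1 → c'.C.length ≤ c.C.length + 1 →
    noiseWeight p T S c θ τ ≤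
      ENNReal.ofReal (Real.exp (p.epsHat / 2)) * noiseWeight p T S c' (θ + 1) τ
  | 0, _, _, _, _, _, _, _, _, _ => by
    have := p.epsHat_pos
    simp only [noiseWeight, mul_one, ENNReal.one_le_ofReal]
    exact Real.one_le_exp (by positivity)
  | T + 1, S, c, c', θ, τ, hwt, hk, h1, h2 => by
    have hp1 : (c.push (S 0)).length ≤ (c'.push (S 0)).length + 1 := by
      unfold Core.push; rw [hwt]; split_ifs <;> simpa using by assumption
    have hp2 : (c'.push (S 0)).length ≤ (c.push (S 0)).length + 1 := by
      unfold Core.push; rw [hwt]; split_ifs <;> simpa using by assumption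
    induction τ using transcript_cases with
    | h0 τ =>
      rw [noiseWeight_cons_none, noiseWeight_cons_none]
      refine (mul_le_mul' (skipProb_le p hk hp2 θ) (noiseWeight_le_of_length T _ (c.skip (S 0))
        (c'.skip (S 0)) θ τ hwt hk hp1 hp2)).trans (le_of_eq ?_)
      ring
    | h1 J τ =>
      rw [noiseWeight_cons_some, noiseWeight_cons_some, ← mul_assoc]
      refine mul_le_mul' (updateProb_le p hk hp1 θ) (le_of_eq ?_)
      refine lintegral_congr fun ξ => ?_
      exact noiseWeight_congr p T _ _ _ _ τ rfl rfl (congrArg (· + 1) hk)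

lemma lintegral_laplace_two_le (f : ℝ → ENNReal) :
    ∫⁻ ξ, f (p.L + ξ + 1) ∂laplace (2 / p.epsHat) ≤
      ENNReal.ofReal (Real.exp (p.epsHat / 2)) * ∫⁻ ξ, f (p.L + ξ) ∂laplace (2 / p.epsHat) := by
  have hε := p.epsHat_pos
  have h := lintegral_laplace_add_le (b := 2 / p.epsHat) (by positivity) 1 fun ξ => f (p.L + ξ)
  rw [show |(1 : ℝ)| / (2 / p.epsHat) = p.epsHat / 2 by simp] at h
  simpa only [add_assoc] using h

lemma ofReal_exp_half_mul_self (x : ℝ) : ENNReal.ofReal (Real.exp (x / 2)) *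
    ENNReal.ofReal (Real.exp (x / 2)) = ENNReal.ofReal (Real.exp x) := by
  rw [← ENNReal.ofReal_mul (Real.exp_pos _).le, ← Real.exp_add, add_halves]

/-- In the first case the change happened after a later redraw of the threshold and is already paid
for. In the second, undoing the unit shift of a `Lap(2 / epsHat)` threshold costs the other `exp
(epsHat / 2)`. -/
lemma lintegral_noise_le {f g : ℝ → ENNReal}
    (h : (∀ θ, f θ ≤ ENNReal.ofReal (Real.exp p.epsHat) * g θ) ∨
      ∀ θ, f θ ≤ ENNReal.ofReal (Real.exp (p.epsHat / 2)) * g (θ + 1)) :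
    ∫⁻ ξ, f (p.L + ξ) ∂laplace (2 / p.epsHat) ≤
      ENNReal.ofReal (Real.exp p.epsHat) * ∫⁻ ξ, g (p.L + ξ) ∂laplace (2 / p.epsHat) := by
  rcases h with h | h
  · rw [← lintegral_const_mul' _ _ ENNReal.ofReal_ne_top]
    exact lintegral_mono fun ξ => h _
  · refine (lintegral_mono fun ξ => h (p.L + ξ)).trans ?_
    rw [lintegral_const_mul' _ _ ENNReal.ofReal_ne_top, ← ofReal_exp_half_mul_self p.epsHat, mul_assoc]
    exact mul_le_mul_right (lintegral_laplace_two_le p g) _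

/-- Privacy of AboveThreshold: if an update precedes the round in which the samples differ, the
threshold need not be shifted; otherwise it is shifted by one. -/
lemma noiseWeight_le_of_neighbors : ∀ (T : ℕ) (S S' : Fin T → Example ι) (_ : Neighbors S S')
    (c : Core ι) (τ : Fin T → Option (Fin p.m → ι)),
    (∀ θ, noiseWeight p T S c θ τ ≤
      ENNReal.ofReal (Real.exp p.epsHat) * noiseWeight p T S' c θ τ) ∨
    (∀ θ, noiseWeight p T S c θ τ ≤
      ENNReal.ofReal (Real.exp (p.epsHat / 2)) * noiseWeight p T S' c (θ + 1) τ)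
  | 0, _, _, ⟨i, _⟩, _, _ => i.elim0
  | T + 1, S, S', hS, c, τ => by
    rcases hS.cases with ht | ⟨h0, ht⟩
    · right
      intro θ
      have hp1 : (c.push (S 0)).length ≤ (c.push (S' 0)).length + 1 :=
        (c.push_length_le _).trans (Nat.succ_le_succ (c.le_push_length _))
      have hp2 : (c.push (S' 0)).length ≤ (c.push (S 0)).length + 1 :=
        (c.push_length_le _).trans (Nat.succ_le_succ (c.le_push_length _))
      induction τ using transcript_cases with
      | h0 τ =>
        rw [noiseWeight_cons_none, noiseWeight_cons_none, ht]
        refine (mul_le_mul' (skipProb_le p rfl hp2 θ) (noiseWeight_le_of_length p T _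
          (c.skip (S 0)) (c.skip (S' 0)) θ τ rfl rfl hp1 hp2)).trans (le_of_eq ?_)
        ring
      | h1 J τ =>
        rw [noiseWeight_cons_some, noiseWeight_cons_some, ← mul_assoc, ht]
        refine mul_le_mul' (updateProb_le p rfl hp1 θ) (le_of_eq ?_)
        refine lintegral_congr fun ξ => ?_
        exact noiseWeight_congr p T _ _ _ _ τ rfl rfl rfl
    · induction τ using transcript_cases with
      | h0 τ =>
        simp only [noiseWeight_cons_none]
        rw [← h0]
        refine (noiseWeight_le_of_neighbors T _ _ ht (c.skip (S 0)) τ).imp ?_ ?_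
        · intro h θ
          rw [mul_left_comm]
          exact mul_le_mul_right (h θ) _
        · intro h θ
          rw [mul_left_comm]
          -- A shift needed later in the same instance only helps the earlier common skips.
          exact mul_le_mul' (skipProb_mono p c (S 0) (by linarith)) (h θ)
      | h1 J τ =>
        left
        intro θ
        rw [noiseWeight_cons_some, noiseWeight_cons_some, ← h0, mul_left_comm]
        exact mul_le_mul_right (lintegral_noise_le p
          (f := fun θ => noiseWeight p T (Fin.tail S) (c.update p (S 0) J) θ τ)
          (g := fun θ => noiseWeight p T (Fin.tail S') (c.update p (S 0) J) θ τ)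
          (noiseWeight_le_of_neighbors T _ _ ht _ τ)) _

lemma initNoise_le {T : ℕ} {S S' : Fin T → Example ι} (hS : Neighbors S S')
    (τ : Fin T → Option (Fin p.m → ι)) :
    initNoise p S τ ≤ ENNReal.ofReal (Real.exp p.epsHat) * initNoise p S' τ :=
  lintegral_noise_le p
    (f := fun θ => noiseWeight p T S (initCore ι) θ τ)
    (g := fun θ => noiseWeight p T S' (initCore ι) θ τ)
    (noiseWeight_le_of_neighbors p T S S' hS _ τ)

/-! ### The samples: moments of the likelihood ratio. -/

/-- The relation between the states of the executions on neighbouring samples: before the samples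
differ, before the next update, and after it. -/
def Linked {T : ℕ} (S S' : Fin T → Example ι) (c c' : Core ι) : Prop :=
  (c.w = c'.w ∧ c.C = c'.C ∧ Neighbors S S') ∨ (c.w = c'.w ∧ S = S') ∨
    (Close (4 * p.eta) c.w c'.w ∧ c.C = c'.C ∧ S = S')

lemma Linked.skip {T : ℕ} {S S' : Fin (T + 1) → Example ι} {c c' : Core ι}
    (h : Linked p S S' c c') (hwt : c.wt = c'.wt) :
    Linked p (Fin.tail S) (Fin.tail S') (c.skip (S 0)) (c'.skip (S' 0)) := by
  rcases h with ⟨hw, hC, hS⟩ | ⟨hw, rfl⟩ | ⟨hw, hC, rfl⟩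
  · rcases hS.cases with ht | ⟨h0, ht⟩
    · exact Or.inr (Or.inl ⟨hw, ht⟩)
    · exact Or.inl ⟨hw, h0 ▸ push_congr hwt hC _, ht⟩
  · exact Or.inr (Or.inl ⟨hw, rfl⟩)
  · exact Or.inr (Or.inr ⟨hw, push_congr hwt hC _, rfl⟩)

/-- Only an update from possibly different caches can separate equal private weights. Once they are
separated the caches agree again, and `Close.updatedWeights` keeps the same constant. -/
lemma Linked.update {T : ℕ} {S S' : Fin (T + 1) → Example ι} {c c' : Core ι}
    (h : Linked p S S' c c') (hwt : c.wt = c'.wt) (hc : IsDist c.w) (hc' : IsDist c'.w) :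
    Close (4 * p.eta) (updatedWeights p.eta c.w (c.push (S 0)))
        (updatedWeights p.eta c'.w (c'.push (S' 0))) ∧
      ∀ J, Linked p (Fin.tail S) (Fin.tail S') (c.update p (S 0) J) (c'.update p (S' 0) J) := by
  have he := p.eta_pos.le
  rcases h with ⟨hw, hC, hS⟩ | ⟨hw, rfl⟩ | ⟨hw, hC, rfl⟩
  · have hcl : Close (4 * p.eta) (updatedWeights p.eta c.w (c.push (S 0)))
        (updatedWeights p.eta c'.w (c'.push (S' 0))) := by
      rw [← hw]
      exact close_updatedWeights hc he _ _
    refine ⟨hcl, fun J => ?_⟩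
    rcases hS.cases with ht | ⟨h0, ht⟩
    · exact Or.inr (Or.inr ⟨hcl, rfl, ht⟩)
    · refine Or.inl ⟨?_, rfl, ht⟩
      simp only [Core.update]
      rw [← h0, hw, push_congr hwt hC]
  · have hcl : Close (4 * p.eta) (updatedWeights p.eta c.w (c.push (S 0)))
        (updatedWeights p.eta c'.w (c'.push (S 0))) := by
      rw [← hw]
      exact close_updatedWeights hc he _ _
    exact ⟨hcl, fun J => Or.inr (Or.inr ⟨hcl, rfl, rfl⟩)⟩
  · have hcl : Close (4 * p.eta) (updatedWeights p.eta c.w (c.push (S 0)))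
        (updatedWeights p.eta c'.w (c'.push (S 0))) := by
      rw [push_congr hwt hC]
      exact hw.updatedWeights hc hc' _ _
    exact ⟨hcl, fun J => Or.inr (Or.inr ⟨hcl, rfl, rfl⟩)⟩

/-- A weighted sum over samples that factorizes. -/
lemma sum_prod_mul_rpow {c l : ℝ} {w w' : ι → ℝ} (h : Close c w w') (hw : IsDist w)
    (hw' : IsDist w') (hc : 0 < c) (hl : 0 ≤ l) (m : ℕ) :
    ∑ J : Fin m → ι, (∏ i, w (J i)) * ((∏ i, w (J i)) / ∏ i, w' (J i)) ^ l ≤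
      Real.exp ((l + 1) ^ 2 * c ^ 2 / 2) ^ m := by
  have e : ∀ J : Fin m → ι, (∏ i, w (J i)) * ((∏ i, w (J i)) / ∏ i, w' (J i)) ^ l =
      ∏ i, (w (J i) * (w (J i) / w' (J i)) ^ l) := by
    intro J
    rw [← Finset.prod_div_distrib, ← Real.finsetProd_rpow _ _ fun i _ =>
      (div_pos (hw.pos _) (hw'.pos _)).le, Finset.prod_mul_distrib]
  rw [Finset.sum_congr rfl fun J _ => e J,
    ← Fintype.sum_pow (fun j => w j * (w j / w' j) ^ l) m]
  refine pow_le_pow_left₀ (Finset.sum_nonneg fun j _ => ?_) (h.sum_mul_rpow_le hw hw' hc hl) m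
  exact mul_nonneg (hw.pos j).le (Real.rpow_nonneg (div_pos (hw.pos j) (hw'.pos j)).le _)

/-- The moments of the likelihood ratio of the samples. -/
lemma sum_noiseWeight_mul_ratio_le {l : ℝ} (hl : 0 ≤ l) :
    ∀ (T : ℕ) (S S' : Fin T → Example ι) (c c' : Core ι) (θ : ℝ),
    IsDist c.w → IsDist c'.w → c.wt = c'.wt → Linked p S S' c c' →
    ∑ τ : Fin T → Option (Fin p.m → ι), noiseWeight p T S c θ τ *
        ENNReal.ofReal (sampleWeight p T S c τ *
          (sampleWeight p T S c τ / sampleWeight p T S' c' τ) ^ l) ≤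
      ENNReal.ofReal (Real.exp ((l + 1) ^ 2 * (4 * p.eta) ^ 2 / 2) ^ p.m) ^ (p.K - c.k)
  | 0, _, _, _, _, _, _, _, _, _ => by
    simp only [noiseWeight, sampleWeight]
    simp only [Finset.univ_unique, Finset.sum_singleton, div_one, Real.one_rpow, mul_one,
      ENNReal.ofReal_one]
    refine one_le_pow₀ (ENNReal.one_le_ofReal.2 (one_le_pow₀ (Real.one_le_exp (by positivity))))
  | T + 1, S, S', c, c', θ, hc, hc', hwt, hL => by
    set E : ENNReal := ENNReal.ofReal (Real.exp ((l + 1) ^ 2 * (4 * p.eta) ^ 2 / 2) ^ p.m)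
      with hE
    obtain ⟨hcl, hLu⟩ := hL.update p hwt hc hc'
    have hw := hc.updatedWeights p.eta (c.push (S 0))
    have hw' := hc'.updatedWeights p.eta (c'.push (S' 0))
    rw [sum_transcript]
    simp only [noiseWeight_cons_none, sampleWeight_cons_none, noiseWeight_cons_some,
      sampleWeight_cons_some]
    have h1 : ∑ τ : Fin T → Option (Fin p.m → ι),
        skipProb p c (S 0) θ * noiseWeight p T (Fin.tail S) (c.skip (S 0)) θ τ *
          ENNReal.ofReal (sampleWeight p T (Fin.tail S) (c.skip (S 0)) τ *
            (sampleWeight p T (Fin.tail S) (c.skip (S 0)) τ /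
              sampleWeight p T (Fin.tail S') (c'.skip (S' 0)) τ) ^ l) ≤
        skipProb p c (S 0) θ * E ^ (p.K - c.k) := by
      simp only [mul_assoc]
      rw [← Finset.mul_sum]
      exact mul_le_mul_right (sum_noiseWeight_mul_ratio_le hl T (Fin.tail S) (Fin.tail S')
        (c.skip (S 0)) (c'.skip (S' 0)) θ hc hc' hwt (hL.skip p hwt)) _
    have h2 : ∑ J : Fin p.m → ι, ∑ τ : Fin T → Option (Fin p.m → ι),
        (updateProb p c (S 0) θ *
          ∫⁻ ξ, noiseWeight p T (Fin.tail S) (c.update p (S 0) J) (p.L + ξ) τ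
            ∂laplace (2 / p.epsHat)) *
          ENNReal.ofReal ((∏ i, updatedWeights p.eta c.w (c.push (S 0)) (J i)) *
            sampleWeight p T (Fin.tail S) (c.update p (S 0) J) τ *
            ((∏ i, updatedWeights p.eta c.w (c.push (S 0)) (J i)) *
              sampleWeight p T (Fin.tail S) (c.update p (S 0) J) τ /
              ((∏ i, updatedWeights p.eta c'.w (c'.push (S' 0)) (J i)) *
                sampleWeight p T (Fin.tail S') (c'.update p (S' 0) J) τ)) ^ l) ≤
        updateProb p c (S 0) θ * E ^ (p.K - c.k) := by
      -- When the budget is exhausted the update probability vanishes, so the truncated subtraction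
      -- in the exponent does no harm.
      by_cases hk : c.k < p.K
      · have hstep : ∀ J : Fin p.m → ι, ∑ τ : Fin T → Option (Fin p.m → ι),
            (∫⁻ ξ, noiseWeight p T (Fin.tail S) (c.update p (S 0) J) (p.L + ξ) τ
              ∂laplace (2 / p.epsHat)) *
            ENNReal.ofReal (sampleWeight p T (Fin.tail S) (c.update p (S 0) J) τ *
              (sampleWeight p T (Fin.tail S) (c.update p (S 0) J) τ /
                sampleWeight p T (Fin.tail S') (c'.update p (S' 0) J) τ) ^ l) ≤
            E ^ (p.K - (c.k + 1)) := by
          intro J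
          rw [sum_lintegral_noiseWeight_mul]
          have := laplace_two_prob p
          refine (lintegral_mono fun ξ => sum_noiseWeight_mul_ratio_le hl T (Fin.tail S)
            (Fin.tail S') (c.update p (S 0) J) (c'.update p (S' 0) J) (p.L + ξ) hw hw' rfl
            (hLu J)).trans ?_
          simp [Core.update, hE]
        have hsum : ∑ J : Fin p.m → ι, ENNReal.ofReal
            ((∏ i, updatedWeights p.eta c.w (c.push (S 0)) (J i)) *
            ((∏ i, updatedWeights p.eta c.w (c.push (S 0)) (J i)) /
              ∏ i, updatedWeights p.eta c'.w (c'.push (S' 0)) (J i)) ^ l) ≤ E := by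
          rw [← ENNReal.ofReal_sum_of_nonneg fun J _ => ?_]
          · exact ENNReal.ofReal_le_ofReal (sum_prod_mul_rpow hcl hw hw'
              (mul_pos (by norm_num) p.eta_pos) hl p.m)
          · have a := Finset.prod_pos fun i (_ : i ∈ Finset.univ) => hw.pos (J i)
            have b := Finset.prod_pos fun i (_ : i ∈ Finset.univ) => hw'.pos (J i)
            positivity
        calc _ = ∑ J : Fin p.m → ι, updateProb p c (S 0) θ * (ENNReal.ofReal
            ((∏ i, updatedWeights p.eta c.w (c.push (S 0)) (J i)) *
            ((∏ i, updatedWeights p.eta c.w (c.push (S 0)) (J i)) /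
              ∏ i, updatedWeights p.eta c'.w (c'.push (S' 0)) (J i)) ^ l) *
            ∑ τ : Fin T → Option (Fin p.m → ι),
            (∫⁻ ξ, noiseWeight p T (Fin.tail S) (c.update p (S 0) J) (p.L + ξ) τ
              ∂laplace (2 / p.epsHat)) *
            ENNReal.ofReal (sampleWeight p T (Fin.tail S) (c.update p (S 0) J) τ *
              (sampleWeight p T (Fin.tail S) (c.update p (S 0) J) τ /
                -- The likelihood ratio is multiplicative, so its `l`-th power splits into the
                -- current samples and the future.
                sampleWeight p T (Fin.tail S') (c'.update p (S' 0) J) τ) ^ l)) := by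
              refine Finset.sum_congr rfl fun J _ => ?_
              rw [Finset.mul_sum, Finset.mul_sum]
              refine Finset.sum_congr rfl fun τ _ => ?_
              have a := Finset.prod_pos fun i (_ : i ∈ Finset.univ) => hw.pos (J i)
              have b := Finset.prod_pos fun i (_ : i ∈ Finset.univ) => hw'.pos (J i)
              have a' := sampleWeight_pos p T (Fin.tail S) (c.update p (S 0) J) hw τ
              have b' := sampleWeight_pos p T (Fin.tail S') (c'.update p (S' 0) J) hw' τ
              rw [mul_div_mul_comm, Real.mul_rpow (by positivity) (by positivity),
                mul_mul_mul_comm, ENNReal.ofReal_mul (by positivity)]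
              ring
          _ ≤ ∑ J : Fin p.m → ι, updateProb p c (S 0) θ * (ENNReal.ofReal
            ((∏ i, updatedWeights p.eta c.w (c.push (S 0)) (J i)) *
            ((∏ i, updatedWeights p.eta c.w (c.push (S 0)) (J i)) /
              ∏ i, updatedWeights p.eta c'.w (c'.push (S' 0)) (J i)) ^ l) *
              E ^ (p.K - (c.k + 1))) := by
              gcongr with J
              exact hstep J
          _ ≤ updateProb p c (S 0) θ * (E * E ^ (p.K - (c.k + 1))) := by
              rw [← Finset.mul_sum, ← Finset.sum_mul]
              gcongr
          _ = updateProb p c (S 0) θ * E ^ (p.K - c.k) := by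
              rw [← pow_succ', show p.K - (c.k + 1) + 1 = p.K - c.k by omega]
      · have e1 : updateProb p c (S 0) θ = 0 := by
          have : updateSet p c (S 0) θ = ∅ := by ext ν; simp [updateSet, hk]
          simp [updateProb, this]
        simp [e1]
    refine (add_le_add h1 h2).trans ?_
    rw [← add_mul, skipProb_add_updateProb, one_mul]

/-- Privacy of DP-Winnow. -/
lemma dpWinnow_le [Nonempty ι] {T : ℕ} {S S' : Fin T → Example ι} (hS : Neighbors S S')
    {l e : ℝ} (hl : 0 ≤ l) (R : Set (Fin T → ι → ℝ)) :
    dpWinnow p S R ≤ ENNReal.ofReal (Real.exp (p.epsHat + e)) * dpWinnow p S' R +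
      ENNReal.ofReal (Real.exp (p.K * p.m * ((l + 1) ^ 2 * (4 * p.eta) ^ 2 / 2) - l * e)) := by
  have hmom : ∑ τ : Fin T → Option (Fin p.m → ι), initNoise p S τ *
        ENNReal.ofReal (sampleWeight p T S (initCore ι) τ *
          (sampleWeight p T S (initCore ι) τ / sampleWeight p T S' (initCore ι) τ) ^ l) ≤
      ENNReal.ofReal (Real.exp (p.K * p.m * ((l + 1) ^ 2 * (4 * p.eta) ^ 2 / 2))) := by
    unfold initNoise
    rw [sum_lintegral_noiseWeight_mul]
    have := laplace_two_prob p
    refine (lintegral_mono fun ξ => sum_noiseWeight_mul_ratio_le p hl T S S' (initCore ι)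
      (initCore ι) (p.L + ξ) isDist_uniform isDist_uniform rfl (Or.inl ⟨rfl, rfl, hS⟩)).trans ?_
    rw [lintegral_const, measure_univ, mul_one, ← ENNReal.ofReal_pow (by positivity),
      ← pow_mul, ← Real.exp_nat_mul]
    refine ENNReal.ofReal_le_ofReal (Real.exp_le_exp.2 (le_of_eq ?_))
    simp only [initCore, Nat.sub_zero]
    push_cast
    ring
  rw [dpWinnow_apply, dpWinnow_apply, Finset.mul_sum]
  have hpt : ∀ τ : Fin T → Option (Fin p.m → ι),
      initNoise p S τ * ENNReal.ofReal (sampleWeight p T S (initCore ι) τ) *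
        R.indicator 1 (released T (initCore ι).wt τ) ≤
      ENNReal.ofReal (Real.exp (p.epsHat + e)) *
        (initNoise p S' τ * ENNReal.ofReal (sampleWeight p T S' (initCore ι) τ) *
          R.indicator 1 (released T (initCore ι).wt τ)) +
      ENNReal.ofReal (Real.exp (-(l * e))) * (initNoise p S τ *
        ENNReal.ofReal (sampleWeight p T S (initCore ι) τ *
          (sampleWeight p T S (initCore ι) τ / sampleWeight p T S' (initCore ι) τ) ^ l)) := by
    intro τ
    by_cases hR : released T (initCore ι).wt τ ∈ R
    · simp only [hR, Set.indicator_of_mem, Pi.one_apply, mul_one]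
      have a := sampleWeight_pos p T S (initCore ι) isDist_uniform τ
      have b := sampleWeight_pos p T S' (initCore ι) isDist_uniform τ
      -- Either the sample ratio is at most `exp e` and the transcript is covered multiplicatively,
      -- or its `l`-th power exceeds `exp (l * e)` and Markov's inequality charges it to the
      -- additive term.
      by_cases hab : sampleWeight p T S (initCore ι) τ ≤
          Real.exp e * sampleWeight p T S' (initCore ι) τ
      · refine le_add_right ?_
        refine (mul_le_mul' (initNoise_le p hS τ) (ENNReal.ofReal_le_ofReal hab)).trans
          (le_of_eq ?_)
        rw [ENNReal.ofReal_mul (Real.exp_pos _).le, Real.exp_add,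
          ENNReal.ofReal_mul (Real.exp_pos _).le]
        ring
      · refine le_add_left ?_
        rw [mul_left_comm, ← ENNReal.ofReal_mul (Real.exp_pos _).le]
        refine mul_le_mul_right (ENNReal.ofReal_le_ofReal ?_) _
        have h1 : Real.exp e ≤
            sampleWeight p T S (initCore ι) τ / sampleWeight p T S' (initCore ι) τ := by
          rw [le_div_iff₀ b]; exact (not_le.1 hab).le
        have h2 := Real.rpow_le_rpow (Real.exp_pos e).le h1 hl
        rw [← Real.exp_mul] at h2
        have h3 : 1 ≤ Real.exp (-(l * e)) * (sampleWeight p T S (initCore ι) τ /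
            sampleWeight p T S' (initCore ι) τ) ^ l := by
          calc (1 : ℝ) = Real.exp (-(l * e)) * Real.exp (e * l) := by
                rw [← Real.exp_add, show -(l * e) + e * l = 0 by ring, Real.exp_zero]
            _ ≤ _ := by gcongr
        nlinarith
    · simp [hR]
  refine (Finset.sum_le_sum fun τ _ => hpt τ).trans ?_
  rw [Finset.sum_add_distrib, ← Finset.mul_sum (a := ENNReal.ofReal (Real.exp (-(l * e))))]
  refine add_le_add le_rfl ((mul_le_mul_right hmom _).trans (le_of_eq ?_))
  rw [← ENNReal.ofReal_mul (Real.exp_pos _).le, ← Real.exp_add]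
  congr 2
  ring

end Privacy

/-! ### Decision lists as halfspaces with a margin -/

section DecisionLists

variable {X : Type u} {F : Finset (X → Bool)}

/-- The coordinate of the feature `i` with sign `b`. -/
def signedCoord (b : Bool) (i : Option F) : Coord F := if b then Sum.inl i else Sum.inr i

lemma pm_expand_signedCoord (x : X) (b : Bool) (i : Option F) :
    pm (expand F x (signedCoord b i)) = pm b * pm (features F x i) := by
  cases b <;> cases h : features F x i <;> simp [signedCoord, expand, pm, h]

/-- The inner product of a weight vector with an expanded example. -/
noncomputable def score (w : Coord F → ℝ) (x : X) : ℝ := ∑ j, w j * pm (expand F x j)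

open Classical in
/-- The vector with the single entry `a` at `i`. -/
noncomputable def point {κ : Type*} (i : κ) (a : ℝ) : κ → ℝ := fun j => if j = i then a else 0

lemma sum_point_mul {κ : Type*} [Fintype κ] (i : κ) (a : ℝ) (g : κ → ℝ) :
    ∑ j, point i a j * g j = a * g i := by
  classical
  simp [point]

lemma sum_point {κ : Type*} [Fintype κ] (i : κ) (a : ℝ) : ∑ j, point i a j = a := by
  classical
  simp [point]

lemma point_nonneg {κ : Type*} (i : κ) {a : ℝ} (ha : 0 ≤ a) (j : κ) : 0 ≤ point i a j := by
  unfold point; split_ifs <;> simp [ha]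

/-- Add weight `a` to the rule "if `f` then `b`". -/
noncomputable def addRule (w : Coord F → ℝ) (a : ℝ) (b : Bool) (f : F) : Coord F → ℝ :=
  fun j => w j + point (signedCoord b (some f)) (a / 2) j + point (signedCoord b none) (a / 2) j

/-- The indicator of `f` is half the sum of the feature and the constant coordinate. Sign `b` is
realized by choosing the original or the negated copy, so weights stay nonnegative. -/
lemma score_addRule (w : Coord F → ℝ) (a : ℝ) (b : Bool) (f : F) (x : X) :
    score (addRule w a b f) x = score w x + if f.1 x then pm b * a else 0 := by
  have h : score (addRule w a b f) x = score w x +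
      a / 2 * pm (expand F x (signedCoord b (some f))) +
      a / 2 * pm (expand F x (signedCoord b none)) := by
    simp only [score, addRule, add_mul, Finset.sum_add_distrib, sum_point_mul]
  rw [h, pm_expand_signedCoord, pm_expand_signedCoord]
  cases hf : f.1 x <;> simp only [features, pm, hf] <;> cases b <;> norm_num <;> ring

lemma sum_addRule (w : Coord F → ℝ) (a : ℝ) (b : Bool) (f : F) :
    ∑ j, addRule w a b f j = ∑ j, w j + a := by
  simp only [addRule, Finset.sum_add_distrib, sum_point]
  ring

lemma addRule_nonneg {w : Coord F → ℝ} (hw : ∀ j, 0 ≤ w j) {a : ℝ} (ha : 0 ≤ a) (b : Bool)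
    (f : F) (j : Coord F) : 0 ≤ addRule w a b f j :=
  add_nonneg (add_nonneg (hw j) (point_nonneg _ (by positivity) j))
    (point_nonneg _ (by positivity) j)

/-- The first output bit of a decision list. -/
def firstBit (d : Bool) : List ((X → Bool) × Bool) → Bool
  | [] => d
  | q :: _ => q.2

lemma alternations_cons (q : (X → Bool) × Bool) (l : List ((X → Bool) × Bool)) (d : Bool) :
    (DecisionList.mk (q :: l) d).alternations =
      (DecisionList.mk l d).alternations + if q.2 ≠ firstBit d l then 1 else 0 := by
  cases l <;> simp [DecisionList.alternations, DecisionList.bits, firstBit, List.countP_cons] <;>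
    split_ifs <;> simp_all

lemma pm_eq_neg {b b' : Bool} (h : b ≠ b') : pm b = -pm b' := by
  cases b <;> cases b' <;> simp_all [pm]

/-- Weights for a decision list. Up to the sign of the first bit, the score lies between `-O` and
`H`; the number `k` of rules of the first block and the bound `Y` on the earlier weights control
the growth of `H + O`. -/
lemma exists_weights (d : Bool) (r : ℕ) : ∀ l : List ((X → Bool) × Bool),
    (∀ q ∈ l, q.1 ∈ F) → l.length + 1 ≤ r →
    ∃ (w : Coord F → ℝ) (H O Y : ℝ) (k : ℕ), (∀ j, 0 ≤ w j) ∧ ∑ j, w j ≤ H + O ∧ 0 ≤ O ∧ 0 ≤ H ∧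
      (∀ x, -O ≤ pm (firstBit d l) * score w x) ∧ (∀ x, pm (firstBit d l) * score w x ≤ H) ∧
      (∀ x, 1 ≤ pm (evalRules d x l) * score w x) ∧
      1 + O ≤ Y ∧ 1 + H + O ≤ (1 + k) * Y ∧ k ≤ l.length ∧
      (((DecisionList.mk l d).alternations = 0 ∧ Y = 2 ∧ k = 0 ∧
          ∀ x, evalRules d x l = firstBit d l) ∨
        ∃ D, (DecisionList.mk l d).alternations = D + 1 ∧ Y ≤ 2 * (r : ℝ) ^ D)
  | [], _, _ => by
    have h : ∀ x, score (point (signedCoord (F := F) d none) 1) x = pm d := by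
      intro x
      rw [score, sum_point_mul, pm_expand_signedCoord]
      simp [features, pm]
    refine ⟨point (signedCoord d none) 1, 1, 0, 2, 0, point_nonneg _ zero_le_one,
      by rw [sum_point, add_zero], le_rfl, zero_le_one, fun x => ?_, fun x => ?_, fun x => ?_,
      by norm_num, by norm_num, le_rfl, Or.inl ⟨by
        simp [DecisionList.alternations, DecisionList.bits], rfl, rfl, fun x => rfl⟩⟩
    all_goals simp [h, firstBit, evalRules, pm_mul_self]
  | q :: l, hF, hr => by
    obtain ⟨w, H, O, Y, k, hw, hsum, hO, hH, hlo, hhi, hev, h1, h2, hk, hD⟩ :=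
      exists_weights d r l (fun q hq => hF q (List.mem_cons_of_mem _ hq))
        ((Nat.le_succ _).trans (by simpa using hr))
    have hrl : l.length + 1 + 1 ≤ r := by simpa using hr
    have hY : 0 ≤ Y := by linarith
    set f : F := ⟨q.1, hF q List.mem_cons_self⟩
    have halt := alternations_cons q l d
    have hev' : ∀ x, evalRules d x (q :: l) = if q.1 x then q.2 else evalRules d x l :=
      fun x => rfl
    have hfirst : firstBit d (q :: l) = q.2 := rfl
    by_cases hq : q.2 = firstBit d l
    · have hb1 := pm_mul_self q.2
      rw [if_neg (by simpa using hq), add_zero] at halt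
      rcases hD with ⟨h0, hY2, hk0, hconst⟩ | ⟨D, hD, hYD⟩
      -- So far the list is constant, so the rule is redundant and gets no weight. This keeps `Y =
      -- 2`, `k = 0` and saves a factor `r` in the final bound.
      · refine ⟨w, H, O, Y, k, hw, hsum, hO, hH, ?_, ?_, ?_, h1, h2, by simp; omega,
          Or.inl ⟨by rw [halt, h0], hY2, hk0, ?_⟩⟩
        · rw [hfirst, hq]; exact hlo
        · rw [hfirst, hq]; exact hhi
        · intro x
          have := hev x
          rw [hev', hconst x, hq, ite_self]
          rwa [hconst x] at this
        · intro x
          rw [hev', hconst x, hfirst, hq, ite_self]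
      -- Same block: weight `1 + O` outvotes the opposing score `O`, and the range grows by only `1
      -- + O ≤ Y`.
      · refine ⟨addRule w (1 + O) q.2 f, H + (1 + O), O, Y, k + 1,
          addRule_nonneg hw (by linarith) _ _, by rw [sum_addRule]; linarith, hO, by linarith,
          fun x => ?_, fun x => ?_, fun x => ?_, h1, by push_cast; linarith, by simpa using hk,
          Or.inr ⟨D, by rw [halt, hD], hYD⟩⟩
        all_goals
          have a1 := hlo x
          have a2 := hhi x
          have a3 := hev x
          rw [← hq] at a1 a2
          rw [score_addRule]
        · rw [hfirst]
          split_ifs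
          · rw [mul_add, ← mul_assoc, hb1]; linarith
          · rwa [add_zero]
        · rw [hfirst]
          split_ifs
          · rw [mul_add, ← mul_assoc, hb1]; linarith
          · rw [add_zero]; linarith
        · rw [hev']
          by_cases hx : q.1 x
          · rw [if_pos hx, if_pos hx, mul_add, ← mul_assoc, hb1]; linarith
          · rw [if_neg hx, if_neg hx, add_zero]; exact a3
    · have hb1 := pm_mul_self q.2
      have hneg := pm_eq_neg (Ne.symm hq)
      rw [if_pos hq] at halt
      -- A new block: the roles of `H` and `O` are exchanged, so weight `1 + H` is needed. The bound
      -- `Y` is multiplied by `1 + k ≤ r`, once per alternation after the first nonconstant step.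
      refine ⟨addRule w (1 + H) q.2 f, O + (1 + H), H, (1 + k) * Y, 1,
        addRule_nonneg hw (by linarith) _ _, by rw [sum_addRule]; linarith, hH, by linarith,
        fun x => ?_, fun x => ?_, fun x => ?_, by linarith, by push_cast; linarith, by simp,
        Or.inr ⟨(DecisionList.mk l d).alternations, halt, ?_⟩⟩
      rotate_right
      · rcases hD with ⟨h0, hY2, hk0, -⟩ | ⟨D, hD, hYD⟩
        · rw [h0, hY2, hk0]; norm_num
        · have hkr : (1 + k : ℝ) ≤ r := by
            have : 1 + k ≤ r := by omega
            exact_mod_cast this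
          rw [hD, pow_succ]
          calc (1 + k : ℝ) * Y ≤ r * (2 * (r : ℝ) ^ D) :=
                mul_le_mul hkr hYD hY (Nat.cast_nonneg r)
            _ = _ := by ring
      all_goals
        have a1 := hlo x
        have a2 := hhi x
        have a3 := hev x
        rw [hneg] at a1 a2
        rw [score_addRule]
      · rw [hfirst]
        split_ifs
        · rw [mul_add, ← mul_assoc, hb1]; linarith
        · rw [add_zero]; linarith
      · rw [hfirst]
        split_ifs
        · rw [mul_add, ← mul_assoc, hb1]; linarith
        · rw [add_zero]; linarith
      · rw [hev']
        by_cases hx : q.1 x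
        · rw [if_pos hx, if_pos hx, mul_add, ← mul_assoc, hb1]; linarith
        · rw [if_neg hx, if_neg hx, add_zero]; exact a3

/-- Decision lists of length `r` with `D` alternations have margin `1 / (2 r ^ D)`. -/
lemma exists_margin {r D : ℕ} (hr : 1 ≤ r) {c : X → Bool} (hc : c ∈ decisionLists F r D) :
    ∃ w : Coord F → ℝ, (∀ j, 0 ≤ w j) ∧ ∑ j, w j ≤ 1 ∧
      ∀ x, 1 / (2 * (r : ℝ) ^ D) ≤ margin w (expand F x, c x) := by
  obtain ⟨⟨l, d⟩, hF, hlen, halt, rfl⟩ := hc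
  simp only [DecisionList.length] at hlen
  obtain ⟨w, H, O, Y, k, hw, hsum, hO, hH, -, -, hev, h1, h2, hk, hD⟩ :=
    exists_weights (F := F) d r l hF hlen.le
  have hr1 : (1 : ℝ) ≤ r := by exact_mod_cast hr
  have hW : (1 + k) * Y ≤ 2 * (r : ℝ) ^ D := by
    have hmono : (r : ℝ) ^ (DecisionList.mk l d).alternations ≤ (r : ℝ) ^ D :=
      pow_le_pow_right₀ hr1 halt
    rcases hD with ⟨h0, rfl, rfl, -⟩ | ⟨D', hD, hYD⟩
    · have := one_le_pow₀ hr1 (n := D)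
      norm_num; linarith
    · have hkr : (1 + k : ℝ) ≤ r := by
        have : 1 + k ≤ r := by omega
        exact_mod_cast this
      calc (1 + k : ℝ) * Y ≤ r * (2 * (r : ℝ) ^ D') :=
            mul_le_mul hkr hYD (by linarith) (Nat.cast_nonneg r)
        _ = 2 * (r : ℝ) ^ (D' + 1) := by ring
        _ ≤ _ := by rw [← hD]; linarith
  have hpos : 0 < 2 * (r : ℝ) ^ D := by positivity
  refine ⟨fun j => w j / (2 * (r : ℝ) ^ D), fun j => div_nonneg (hw j) hpos.le, ?_, fun x => ?_⟩
  · rw [← Finset.sum_div, div_le_one hpos]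
    linarith
  · have h := hev x
    have e : margin (fun j => w j / (2 * (r : ℝ) ^ D)) (expand F x, evalRules d x l) =
        pm (evalRules d x l) * score w x / (2 * (r : ℝ) ^ D) := by
      simp only [margin, score, div_mul_eq_mul_div, ← Finset.sum_div]
      rw [mul_div_assoc]
    change _ ≤ margin _ (expand F x, evalRules d x l)
    rw [e]
    gcongr

end DecisionLists

/-! ### Accuracy -/

section Accuracy

variable {ι : Type u} [Fintype ι]

/-- Samples from `w` preserve the sign of margins above `g / 2`. -/
lemma sum_bad_samples_le {w : ι → ℝ} (hw : IsDist w) {g : ℝ} (hg0 : 0 < g) (hg1 : g ≤ 1) {m : ℕ}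
    (hm : 0 < m) (z : Example ι) (hz : g / 2 < margin w z) (P : (Fin m → ι) → Prop)
    [DecidablePred P] (hP : ∀ J, P J → margin (empirical J) z ≤ 0) :
    ∑ J : Fin m → ι, (if P J then ∏ i, w (J i) else 0) ≤ Real.exp (-(m * g ^ 2 / 16)) := by
  have hmarg : ∀ J : Fin m → ι, ∑ i, pm z.2 * pm (z.1 (J i)) = m * margin (empirical J) z := by
    intro J
    classical
    have hm' : (m : ℝ) ≠ 0 := by positivity
    rw [margin_eq_sum, Finset.mul_sum,
      ← Finset.sum_fiberwise Finset.univ J fun i => pm z.2 * pm (z.1 (J i))]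
    refine Finset.sum_congr rfl fun j _ => ?_
    rw [Finset.sum_congr rfl (g := fun _ => pm z.2 * pm (z.1 j)) fun i hi => by
      rw [(Finset.mem_filter.1 hi).2]]
    rw [Finset.sum_const, nsmul_eq_mul]
    simp only [empirical]
    rw [← mul_assoc (m : ℝ), mul_div_cancel₀ _ hm']
  -- Chernoff: on the bad event the exponential is at least one. The parameter `-(g / 4)` optimizes
  -- `-t * g / 2 + t ^ 2` and yields `-g ^ 2 / 16`.
  have hstep : ∀ J : Fin m → ι, (if P J then ∏ i, w (J i) else 0) ≤
      ∏ i, w (J i) * Real.exp (-(g / 4) * (pm z.2 * pm (z.1 (J i)))) := by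
    intro J
    have hpos : 0 < ∏ i, w (J i) := Finset.prod_pos fun i _ => hw.pos _
    rw [Finset.prod_mul_distrib, ← Real.exp_sum, ← Finset.mul_sum, hmarg]
    split_ifs with h
    · have h1 := hP J h
      refine le_mul_of_one_le_right hpos.le (Real.one_le_exp ?_)
      have : (m : ℝ) * margin (empirical J) z ≤ 0 :=
        mul_nonpos_of_nonneg_of_nonpos (Nat.cast_nonneg m) h1
      nlinarith
    · positivity
  refine (Finset.sum_le_sum fun J _ => hstep J).trans ?_
  rw [← Fintype.sum_pow (fun j => w j * Real.exp (-(g / 4) * (pm z.2 * pm (z.1 j)))) m]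
  have h := hw.sum_mul_exp_le (t := -(g / 4)) (by rw [abs_neg, abs_of_pos] <;> linarith) z
  calc _ ≤ Real.exp (-(g / 4) * margin w z + (-(g / 4)) ^ 2) ^ m :=
        pow_le_pow_left₀ (hw.sum_exp_pos _).le h m
    _ ≤ Real.exp (-(g ^ 2 / 16)) ^ m := by
        gcongr
        nlinarith
    _ = _ := by rw [← Real.exp_nat_mul]; congr 1; ring

variable (p : Params)

/-- The transcripts on which AboveThreshold and the samples behave as expected: updates take place
only for nonempty caches, the caches have length at most `B`, and the samples preserve the sign of
margins above `g / 2`. -/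
def GoodTranscript (g B : ℝ) : (T : ℕ) → (Fin T → Example ι) → Core ι →
    (Fin T → Option (Fin p.m → ι)) → Prop
  | 0, _, _, _ => True
  | T + 1, S, c, τ =>
    match τ 0 with
    | none => (((c.push (S 0)).length : ℝ) ≤ B ∨ p.K ≤ c.k) ∧
        GoodTranscript g B T (Fin.tail S) (c.skip (S 0)) (Fin.tail τ)
    | some J => c.push (S 0) ≠ [] ∧
        (∀ t, g / 2 < margin (updatedWeights p.eta c.w (c.push (S 0))) (Fin.tail S t) →
          0 < margin (empirical J) (Fin.tail S t)) ∧
        GoodTranscript g B T (Fin.tail S) (c.update p (S 0) J) (Fin.tail τ)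

lemma sum_noiseWeight_eq_one : ∀ (T : ℕ) (S : Fin T → Example ι) (c : Core ι) (θ : ℝ)
    (_ : IsDist c.w), ∑ τ : Fin T → Option (Fin p.m → ι),
      noiseWeight p T S c θ τ * ENNReal.ofReal (sampleWeight p T S c τ) = 1
  | 0, _, _, _, _ => by simp [noiseWeight, sampleWeight]
  | T + 1, S, c, θ, hc => by
    have hw := hc.updatedWeights p.eta (c.push (S 0))
    rw [sum_transcript]
    simp only [noiseWeight_cons_none, sampleWeight_cons_none, noiseWeight_cons_some,
      sampleWeight_cons_some]
    have h2 : ∀ J : Fin p.m → ι, ∑ τ : Fin T → Option (Fin p.m → ι),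
        (updateProb p c (S 0) θ *
          ∫⁻ ξ, noiseWeight p T (Fin.tail S) (c.update p (S 0) J) (p.L + ξ) τ
            ∂laplace (2 / p.epsHat)) *
          ENNReal.ofReal ((∏ i, updatedWeights p.eta c.w (c.push (S 0)) (J i)) *
            sampleWeight p T (Fin.tail S) (c.update p (S 0) J) τ) =
        updateProb p c (S 0) θ *
          ENNReal.ofReal (∏ i, updatedWeights p.eta c.w (c.push (S 0)) (J i)) := by
      intro J
      have hI := sum_lintegral_noiseWeight_mul p (Fin.tail S) (c.update p (S 0) J) fun τ =>
        ENNReal.ofReal (sampleWeight p T (Fin.tail S) (c.update p (S 0) J) τ)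
      have := laplace_two_prob p
      rw [lintegral_congr fun ξ => sum_noiseWeight_eq_one T (Fin.tail S) (c.update p (S 0) J)
        (p.L + ξ) hw, lintegral_const, measure_univ, mul_one] at hI
      rw [← mul_one (updateProb p c (S 0) θ * _), ← hI, Finset.mul_sum]
      refine Finset.sum_congr rfl fun τ _ => ?_
      rw [ENNReal.ofReal_mul (Finset.prod_nonneg fun i _ => (hw.pos _).le)]
      ring
    simp only [h2]
    simp only [mul_assoc]
    rw [← Finset.mul_sum, ← Finset.mul_sum, hw.sum_prod, sum_noiseWeight_eq_one T _ _ _ (by exact hc),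
      mul_one, mul_one, skipProb_add_updateProb]

open Classical in
/-- The probability of a bad transcript. -/
lemma sum_bad_transcripts_le {g B s1 s2 : ℝ} {q0 q1 : ENNReal} (T₀ : ℕ)
    (hs1 : laplace (2 / p.epsHat) {ξ | s1 < |ξ|} ≤ q0)
    (hs2 : laplace (4 / p.epsHat) {ν | s2 ≤ ν} ≤ q0)
    (hs2' : laplace (4 / p.epsHat) {ν | ν ≤ -s2} ≤ q0)
    (hL : s1 + s2 ≤ p.L) (hB : p.L + s1 + s2 ≤ B)
    (hsamp : ∀ w : ι → ℝ, IsDist w → ∀ z : Example ι, g / 2 < margin w z →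
      ∑ J : Fin p.m → ι, (if margin (empirical J) z ≤ 0 then
        ENNReal.ofReal (∏ i, w (J i)) else 0) ≤ q1) :
    ∀ (T : ℕ) (S : Fin T → Example ι) (c : Core ι) (θ : ℝ), T ≤ T₀ → IsDist c.w →
      |θ - p.L| ≤ s1 →
      ∑ τ : Fin T → Option (Fin p.m → ι), (if GoodTranscript p g B T S c τ then 0 else
        noiseWeight p T S c θ τ * ENNReal.ofReal (sampleWeight p T S c τ)) ≤
      T * (3 * q0 + T₀ * q1)
  | 0, _, _, _, _, _, _ => by simp [GoodTranscript]
  | T + 1, S, c, θ, hT, hc, hθ => by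
    -- Failure budget of a round: a long cache without an update, an update on an empty cache, a bad
    -- new threshold, and the samples failing on one of the later examples.
    set κ := 3 * q0 + T₀ * q1 with hκ
    have hθ' := abs_le.1 hθ
    have hT' : T ≤ T₀ := (Nat.le_succ T).trans hT
    have hw := hc.updatedWeights p.eta (c.push (S 0))
    have hprob := laplace_two_prob p
    have ih := sum_bad_transcripts_le T₀ hs1 hs2 hs2' hL hB hsamp T
    rw [sum_transcript]
    have hgn : ∀ τ : Fin T → Option (Fin p.m → ι), GoodTranscript p g B (T + 1) S c
        (Fin.cons (α := fun _ => Option (Fin p.m → ι)) none τ) ↔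
        ((((c.push (S 0)).length : ℝ) ≤ B ∨ p.K ≤ c.k) ∧
          GoodTranscript p g B T (Fin.tail S) (c.skip (S 0)) τ) := fun τ => Iff.rfl
    have hgs : ∀ (J : Fin p.m → ι) (τ : Fin T → Option (Fin p.m → ι)),
        GoodTranscript p g B (T + 1) S c
        (Fin.cons (α := fun _ => Option (Fin p.m → ι)) (some J) τ) ↔ (c.push (S 0) ≠ [] ∧
        (∀ t, g / 2 < margin (updatedWeights p.eta c.w (c.push (S 0))) (Fin.tail S t) →
          0 < margin (empirical J) (Fin.tail S t)) ∧
        GoodTranscript p g B T (Fin.tail S) (c.update p (S 0) J) τ) := fun J τ => Iff.rfl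
    simp only [noiseWeight_cons_none, sampleWeight_cons_none, noiseWeight_cons_some,
      sampleWeight_cons_some, hgn, hgs]
    have h1 : ∑ τ : Fin T → Option (Fin p.m → ι),
        (if (((c.push (S 0)).length : ℝ) ≤ B ∨ p.K ≤ c.k) ∧
          GoodTranscript p g B T (Fin.tail S) (c.skip (S 0)) τ then 0 else
        skipProb p c (S 0) θ * noiseWeight p T (Fin.tail S) (c.skip (S 0)) θ τ *
          ENNReal.ofReal (sampleWeight p T (Fin.tail S) (c.skip (S 0)) τ)) ≤
        q0 + skipProb p c (S 0) θ * (T * κ) := by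
      by_cases hlen : ((c.push (S 0)).length : ℝ) ≤ B ∨ p.K ≤ c.k
      · refine le_add_left ?_
        refine le_trans (le_of_eq ?_)
          (mul_le_mul_right (ih (Fin.tail S) (c.skip (S 0)) θ hT' hc hθ) _)
        rw [Finset.mul_sum]
        refine Finset.sum_congr rfl fun τ _ => ?_
        simp only [hlen, true_and, mul_ite, mul_zero, mul_assoc]
      -- Here the cache exceeds `B ≥ L + s1 + s2` while the threshold is at most `L + s1`, so a skip
      -- forces noise below `-s2`.
      · refine le_add_right ?_
        simp only [hlen, false_and, if_false, mul_assoc]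
        rw [← Finset.mul_sum, sum_noiseWeight_eq_one p T (Fin.tail S) (c.skip (S 0)) θ hc, mul_one]
        refine le_trans (measure_mono fun ν hν => ?_) hs2'
        push Not at hlen
        by_contra hν'
        have hν' : -s2 < ν := not_le.1 hν'
        exact hν ⟨by linarith, hlen.2⟩
    have h2 : ∑ J : Fin p.m → ι, ∑ τ : Fin T → Option (Fin p.m → ι),
        (if (c.push (S 0) ≠ [] ∧
          (∀ t, g / 2 < margin (updatedWeights p.eta c.w (c.push (S 0))) (Fin.tail S t) →
            0 < margin (empirical J) (Fin.tail S t)) ∧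
          GoodTranscript p g B T (Fin.tail S) (c.update p (S 0) J) τ) then 0 else
        (updateProb p c (S 0) θ *
          ∫⁻ ξ, noiseWeight p T (Fin.tail S) (c.update p (S 0) J) (p.L + ξ) τ
            ∂laplace (2 / p.epsHat)) *
          ENNReal.ofReal ((∏ i, updatedWeights p.eta c.w (c.push (S 0)) (J i)) *
            sampleWeight p T (Fin.tail S) (c.update p (S 0) J) τ)) ≤
        q0 + updateProb p c (S 0) θ * (T₀ * q1 + q0 + T * κ) := by
      have hfac : ∀ (J : Fin p.m → ι) (P : (Fin T → Option (Fin p.m → ι)) → Prop)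
          [DecidablePred P],
          ∑ τ : Fin T → Option (Fin p.m → ι), (if P τ then 0 else
          (updateProb p c (S 0) θ *
            ∫⁻ ξ, noiseWeight p T (Fin.tail S) (c.update p (S 0) J) (p.L + ξ) τ
              ∂laplace (2 / p.epsHat)) *
            ENNReal.ofReal ((∏ i, updatedWeights p.eta c.w (c.push (S 0)) (J i)) *
              sampleWeight p T (Fin.tail S) (c.update p (S 0) J) τ)) =
          updateProb p c (S 0) θ *
            (ENNReal.ofReal (∏ i, updatedWeights p.eta c.w (c.push (S 0)) (J i)) *
            ∫⁻ ξ, ∑ τ : Fin T → Option (Fin p.m → ι), (if P τ then 0 else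
              noiseWeight p T (Fin.tail S) (c.update p (S 0) J) (p.L + ξ) τ *
              ENNReal.ofReal (sampleWeight p T (Fin.tail S) (c.update p (S 0) J) τ))
              ∂laplace (2 / p.epsHat)) := by
        intro J P _
        have hI := sum_lintegral_noiseWeight_mul p (Fin.tail S) (c.update p (S 0) J) fun τ =>
          if P τ then 0 else
            ENNReal.ofReal (sampleWeight p T (Fin.tail S) (c.update p (S 0) J) τ)
        simp only [mul_ite, mul_zero] at hI
        rw [← hI, Finset.mul_sum, Finset.mul_sum]
        refine Finset.sum_congr rfl fun τ _ => ?_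
        split_ifs
        · simp
        · rw [ENNReal.ofReal_mul (Finset.prod_nonneg fun i _ => (hw.pos _).le)]
          ring
      have hle1 : ∀ (J : Fin p.m → ι) (P : (Fin T → Option (Fin p.m → ι)) → Prop)
          [DecidablePred P] (ξ : ℝ),
          ∑ τ : Fin T → Option (Fin p.m → ι), (if P τ then 0 else
              noiseWeight p T (Fin.tail S) (c.update p (S 0) J) (p.L + ξ) τ *
              ENNReal.ofReal (sampleWeight p T (Fin.tail S) (c.update p (S 0) J) τ)) ≤ 1 := by
        intro J P _ ξ
        rw [← sum_noiseWeight_eq_one p T (Fin.tail S) (c.update p (S 0) J) (p.L + ξ) hw]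
        refine Finset.sum_le_sum fun τ _ => ?_
        split_ifs <;> simp
      refine le_trans (le_of_eq (Finset.sum_congr rfl fun J _ => hfac J _)) ?_
      rw [← Finset.mul_sum]
      by_cases hC : c.push (S 0) = []
      -- On an empty cache an update needs noise of at least `θ ≥ L - s1 ≥ s2`; the whole future is
      -- bounded by one.
      · refine le_add_right (le_trans (mul_le_of_le_one_right' ?_) (le_trans (measure_mono
          fun ν hν => ?_) hs2))
        · rw [← hw.sum_prod p.m]
          refine Finset.sum_le_sum fun J _ => mul_le_of_le_one_right' ?_
          refine (lintegral_mono fun ξ => hle1 J _ ξ).trans ?_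
          simp
        · have := hν.1
          rw [hC] at this
          simp only [List.length_nil, Nat.cast_zero, zero_add] at this
          change s2 ≤ ν
          linarith
      · refine le_add_left (mul_le_mul_right ?_ _)
        have hJ : ∀ J : Fin p.m → ι,
            ENNReal.ofReal (∏ i, updatedWeights p.eta c.w (c.push (S 0)) (J i)) *
            ∫⁻ ξ, ∑ τ : Fin T → Option (Fin p.m → ι), (if (c.push (S 0) ≠ [] ∧
              (∀ t, g / 2 < margin (updatedWeights p.eta c.w (c.push (S 0))) (Fin.tail S t) →
                0 < margin (empirical J) (Fin.tail S t)) ∧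
              GoodTranscript p g B T (Fin.tail S) (c.update p (S 0) J) τ) then 0 else
              noiseWeight p T (Fin.tail S) (c.update p (S 0) J) (p.L + ξ) τ *
              ENNReal.ofReal (sampleWeight p T (Fin.tail S) (c.update p (S 0) J) τ))
              ∂laplace (2 / p.epsHat) ≤
            (∑ t : Fin T, if g / 2 < margin (updatedWeights p.eta c.w (c.push (S 0)))
                (Fin.tail S t) ∧ margin (empirical J) (Fin.tail S t) ≤ 0 then
              ENNReal.ofReal (∏ i, updatedWeights p.eta c.w (c.push (S 0)) (J i)) else 0) +
            ENNReal.ofReal (∏ i, updatedWeights p.eta c.w (c.push (S 0)) (J i)) *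
              (q0 + T * κ) := by
          intro J
          by_cases hbad : ∀ t,
              g / 2 < margin (updatedWeights p.eta c.w (c.push (S 0))) (Fin.tail S t) →
                0 < margin (empirical J) (Fin.tail S t)
          · refine le_add_left (mul_le_mul_right ?_ _)
            have hm : MeasurableSet {ξ : ℝ | s1 < |ξ|} :=
              measurableSet_lt measurable_const measurable_id.abs
            calc _ ≤ ∫⁻ ξ, ({ξ : ℝ | s1 < |ξ|}.indicator 1 ξ + T * κ)
                  ∂laplace (2 / p.epsHat) := by
                  refine lintegral_mono fun ξ => ?_
                  by_cases hξ : s1 < |ξ|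
                  · refine le_add_right ?_
                    simpa [hξ] using hle1 J _ ξ
                  · refine le_add_left (le_trans (le_of_eq ?_) (ih (Fin.tail S)
                      (c.update p (S 0) J) (p.L + ξ) hT' hw (by simpa using not_lt.1 hξ)))
                    refine Finset.sum_congr rfl fun τ _ => ?_
                    split_ifs with h h' h'
                    · rfl
                    · exact absurd h.2.2 h'
                    · exact absurd ⟨hC, hbad, h'⟩ h
                    · rfl
              _ ≤ q0 + T * κ := by
                  rw [lintegral_add_right _ measurable_const, lintegral_indicator_one hm,
                    lintegral_const, measure_univ, mul_one]
                  gcongr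
          · push Not at hbad
            obtain ⟨t, ht⟩ := hbad
            refine le_add_right (le_trans (mul_le_of_le_one_right' ?_) (le_trans (le_of_eq ?_)
              (Finset.single_le_sum (fun _ _ => zero_le) (Finset.mem_univ t))))
            · refine (lintegral_mono fun ξ => hle1 J _ ξ).trans ?_
              simp
            · rw [if_pos ht]
        refine (Finset.sum_le_sum fun J _ => hJ J).trans ?_
        rw [Finset.sum_add_distrib, ← Finset.sum_mul, hw.sum_prod, one_mul, add_assoc]
        gcongr
        rw [Finset.sum_comm]
        calc _ ≤ ∑ t : Fin T, q1 := by
              refine Finset.sum_le_sum fun t _ => ?_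
              by_cases ht : g / 2 < margin (updatedWeights p.eta c.w (c.push (S 0)))
                  (Fin.tail S t)
              · simpa only [ht, true_and] using hsamp _ hw _ ht
              · simp [ht]
          _ = T * q1 := by simp
          _ ≤ T₀ * q1 := by gcongr
    refine (add_le_add h1 h2).trans ?_
    have hsum := skipProb_add_updateProb p c (S 0) θ
    have hup : updateProb p c (S 0) θ ≤ 1 := by rw [← hsum]; exact le_add_self
    calc q0 + skipProb p c (S 0) θ * (T * κ) +
          (q0 + updateProb p c (S 0) θ * (T₀ * q1 + q0 + T * κ))
        = q0 + q0 + updateProb p c (S 0) θ * (T₀ * q1 + q0) +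
          (skipProb p c (S 0) θ + updateProb p c (S 0) θ) * (T * κ) := by ring
      _ ≤ q0 + q0 + 1 * (T₀ * q1 + q0) + 1 * (T * κ) := by rw [hsum]; gcongr
      _ = ((T + 1 : ℕ) : ENNReal) * κ := by rw [hκ]; push_cast; ring

/-! ### The mistake bound on good transcripts. -/

/-- The potential of multiplicative weights with respect to a comparison vector `u`. -/
noncomputable def potential (u w : ι → ℝ) : ℝ := ∑ j, u j * -Real.log (w j)

lemma potential_nonneg {u w : ι → ℝ} (hu : ∀ j, 0 ≤ u j) (hw : IsDist w) : 0 ≤ potential u w :=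
  Finset.sum_nonneg fun j _ => mul_nonneg (hu j)
    (neg_nonneg.2 (Real.log_nonpos (hw.pos j).le (hw.le_one j)))

/-- The update gains `eta * g` from the margin of `u` and loses at most `eta * g / 2 + eta ^ 2`
through the normalization; `eta ≤ g / 4` leaves `eta * g / 4`. -/
lemma potential_mwUpdate_le {u w : ι → ℝ} (hu : ∀ j, 0 ≤ u j) (hu1 : ∑ j, u j ≤ 1)
    (hw : IsDist w) {eta g : ℝ} (he : 0 < eta) (heg : eta ≤ g / 4) (hg : g ≤ 1) {z : Example ι}
    (hz : margin w z ≤ g / 2) (huz : g ≤ margin u z) :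
    potential u (mwUpdate eta w z) + eta * g / 4 ≤ potential u w := by
  set Z := ∑ i, w i * Real.exp (eta * (pm z.2 * pm (z.1 i))) with hZdef
  have hZ : 0 < Z := hw.sum_exp_pos _
  have hlogZ : Real.log Z ≤ eta * g / 2 + eta ^ 2 := by
    have h := hw.sum_mul_exp_le (t := eta) (by rw [abs_of_pos he]; linarith) z
    rw [Real.log_le_iff_le_exp hZ]
    refine h.trans (Real.exp_le_exp.2 ?_)
    nlinarith
  have hlog : ∀ j, -Real.log (mwUpdate eta w z j) =
      -Real.log (w j) - eta * (pm z.2 * pm (z.1 j)) + Real.log Z := by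
    intro j
    rw [mwUpdate_eq, Real.log_div (mul_pos (hw.pos j) (Real.exp_pos _)).ne' hZ.ne',
      Real.log_mul (hw.pos j).ne' (Real.exp_pos _).ne', Real.log_exp]
    ring
  have e : potential u (mwUpdate eta w z) =
      potential u w - eta * margin u z + (∑ j, u j) * Real.log Z := by
    simp only [potential, hlog, margin_eq_sum, Finset.mul_sum, Finset.sum_mul]
    rw [← Finset.sum_sub_distrib, ← Finset.sum_add_distrib]
    exact Finset.sum_congr rfl fun j _ => by ring
  have h0 : 0 ≤ ∑ j, u j := Finset.sum_nonneg fun j _ => hu j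
  have h1 : (∑ j, u j) * Real.log Z ≤ eta * g / 2 + eta ^ 2 := by
    have : 0 ≤ eta * g / 2 + eta ^ 2 := by nlinarith
    calc _ ≤ (∑ j, u j) * (eta * g / 2 + eta ^ 2) := mul_le_mul_of_nonneg_left hlogZ h0
      _ ≤ 1 * (eta * g / 2 + eta ^ 2) := by gcongr
      _ = _ := one_mul _
  rw [e]
  nlinarith

/-- The number of prediction errors. -/
noncomputable def errorCount {T : ℕ} (S : Fin T → Example ι) (h : Fin T → ι → ℝ) : ℕ :=
  ∑ t, if halfspace (h t) (S t).1 ≠ (S t).2 then 1 else 0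

lemma errorCount_cons {T : ℕ} (S : Fin (T + 1) → Example ι) (w : ι → ℝ) (h : Fin T → ι → ℝ) :
    errorCount S (Fin.cons (α := fun _ => ι → ℝ) w h) =
      (if halfspace w (S 0).1 ≠ (S 0).2 then 1 else 0) + errorCount (Fin.tail S) h := by
  unfold errorCount
  rw [Fin.sum_univ_succ]
  rfl

/-- The deterministic error bound on good transcripts. -/
lemma errorCount_le {u : ι → ℝ} (hu : ∀ j, 0 ≤ u j) (hu1 : ∑ j, u j ≤ 1) {g B V : ℝ}
    (hB : 0 ≤ B) (heg : p.eta ≤ g / 4) (hg : g ≤ 1) (hV : V < p.K * (p.eta * g / 4)) :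
    ∀ (T : ℕ) (S : Fin T → Example ι) (c : Core ι) (τ : Fin T → Option (Fin p.m → ι)),
    IsDist c.w → (∀ t, g ≤ margin u (S t)) →
    potential u c.w + c.k * (p.eta * g / 4) ≤ V →
    (∀ t, g / 2 < margin c.w (S t) → 0 < margin c.wt (S t)) →
    (∀ z ∈ c.C, margin c.w z ≤ g / 2 ∧ g ≤ margin u z) → (c.C.length : ℝ) ≤ B →
    GoodTranscript p g B T S c τ →
    (errorCount S (released T c.wt τ) : ℝ) + c.C.length ≤ (p.K - c.k) * (B + 1) := by
  have hstep : 0 < p.eta * g / 4 := by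
    have := p.eta_pos
    have : 0 < g := by linarith
    positivity
  -- The potential is nonnegative, so the invariant on it prevents the update budget from running
  -- out.
  have hkK : ∀ c : Core ι, IsDist c.w → potential u c.w + c.k * (p.eta * g / 4) ≤ V →
      c.k < p.K := by
    intro c hc hpot
    have h0 := potential_nonneg hu hc
    have : (c.k : ℝ) * (p.eta * g / 4) < p.K * (p.eta * g / 4) := by linarith
    exact_mod_cast lt_of_mul_lt_mul_right this hstep.le
  intro T
  induction T with
  | zero =>
    intro S c τ hc _ hpot _ _ hlen _
    have hk := hkK c hc hpot
    have hk' : (c.k : ℝ) + 1 ≤ p.K := by exact_mod_cast hk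
    simp only [errorCount, Finset.univ_eq_empty, Finset.sum_empty, Nat.cast_zero, zero_add]
    nlinarith
  | succ T ih =>
    intro S c τ hc hS hpot hwt hC hlen hgood
    have hk := hkK c hc hpot
    have hpl : ((c.push (S 0)).length : ℝ) =
        ((if halfspace c.wt (S 0).1 ≠ (S 0).2 then 1 else 0 : ℕ) : ℝ) + c.C.length := by
      unfold Core.push
      split_ifs <;> simp [add_comm]
    -- The contrapositive of the sampling guarantee: an error of the released vector forces private
    -- margin at most `g / 2`. The private weights are frozen between updates, so this holds for the
    -- whole cache.
    have hpC : ∀ z ∈ c.push (S 0), margin c.w z ≤ g / 2 ∧ g ≤ margin u z := by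
      intro z hz
      unfold Core.push at hz
      split_ifs at hz with herr
      · rcases List.mem_append.1 hz with h | h
        · exact hC z h
        · rw [List.mem_singleton.1 h]
          refine ⟨not_lt.1 fun hlt => herr (halfspace_eq_of_margin_pos (hwt 0 hlt)), hS 0⟩
      · exact hC z hz
    induction τ using transcript_cases with
    | h0 τ =>
      obtain ⟨hl, hgood⟩ := hgood
      have hl := hl.resolve_right (not_le.2 hk)
      have h := ih (Fin.tail S) (c.skip (S 0)) τ hc (fun t => hS _) hpot (fun t => hwt _) hpC hl
        hgood
      have e : errorCount S (released (T + 1) c.wt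
          (Fin.cons (α := fun _ => Option (Fin p.m → ι)) none τ)) =
          (if halfspace c.wt (S 0).1 ≠ (S 0).2 then 1 else 0) +
            errorCount (Fin.tail S) (released T c.wt τ) := errorCount_cons S c.wt _
      rw [e, Nat.cast_add]
      simp only [Core.skip] at h
      linarith
    | h1 J τ =>
      obtain ⟨hne, hJ, hgood⟩ := hgood
      have hpot' : potential u (updatedWeights p.eta c.w (c.push (S 0))) + p.eta * g / 4 ≤
          potential u c.w := by
        obtain ⟨z, l, hzl⟩ := List.exists_cons_of_ne_nil hne
        have hz := hpC z (by rw [hzl]; exact List.mem_cons_self)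
        rw [hzl]
        exact potential_mwUpdate_le hu hu1 hc p.eta_pos heg hg hz.1 hz.2
      have h := ih (Fin.tail S) (c.update p (S 0) J) τ (hc.updatedWeights _ _) (fun t => hS _)
        (by simp only [Core.update]; push_cast; linarith) hJ (by simp [Core.update])
        (by simpa [Core.update] using hB) hgood
      have e : errorCount S (released (T + 1) c.wt
          (Fin.cons (α := fun _ => Option (Fin p.m → ι)) (some J) τ)) =
          (if halfspace c.wt (S 0).1 ≠ (S 0).2 then 1 else 0) +
            errorCount (Fin.tail S) (released T (empirical J) τ) := errorCount_cons S c.wt _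
      -- In the update round the cache may exceed `B` by one; this is the `+ 1` in the bound per
      -- update.
      have hle : (c.push (S 0)).length ≤ c.C.length + 1 := c.push_length_le _
      have hle' : ((c.push (S 0)).length : ℝ) ≤ c.C.length + 1 := by exact_mod_cast hle
      rw [e, Nat.cast_add]
      simp only [Core.update, List.length_nil, Nat.cast_zero, add_zero, Nat.cast_add,
        Nat.cast_one] at h
      linarith

end Accuracy

/-! ### From good transcripts to a probability bound. -/

section Accuracy

variable {ι : Type u} [Fintype ι]

/-- The error bound of DP-Winnow. -/
lemma one_le_dpWinnow_add [Nonempty ι] (p : Params) {T : ℕ} (S : Fin T → Example ι) {u : ι → ℝ}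
    (hu : ∀ j, 0 ≤ u j) (hu1 : ∑ j, u j ≤ 1) {g B s1 s2 : ℝ} {q0 q1 : ENNReal}
    (hB0 : 0 ≤ B) (heg : p.eta ≤ g / 4) (hg : g ≤ 1) (hS : ∀ t, g ≤ margin u (S t))
    (hV : Real.log (Fintype.card ι) < p.K * (p.eta * g / 4))
    (hs1 : laplace (2 / p.epsHat) {ξ | s1 < |ξ|} ≤ q0)
    (hs2 : laplace (4 / p.epsHat) {ν | s2 ≤ ν} ≤ q0)
    (hs2' : laplace (4 / p.epsHat) {ν | ν ≤ -s2} ≤ q0)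
    (hL : s1 + s2 ≤ p.L) (hB : p.L + s1 + s2 ≤ B)
    (hsamp : ∀ w : ι → ℝ, IsDist w → ∀ z : Example ι, g / 2 < margin w z →
      ∑ J : Fin p.m → ι, (if margin (empirical J) z ≤ 0 then
        ENNReal.ofReal (∏ i, w (J i)) else 0) ≤ q1) :
    1 ≤ dpWinnow p S {h | (errorCount S h : ℝ) ≤ p.K * (B + 1)} +
      (q0 + T * (3 * q0 + T * q1)) := by
  classical
  have hprob := laplace_two_prob p
  have hone : ∀ ξ, ∑ τ : Fin T → Option (Fin p.m → ι), noiseWeight p T S (initCore ι) (p.L + ξ) τ *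
      ENNReal.ofReal (sampleWeight p T S (initCore ι) τ) = 1 := fun ξ =>
    sum_noiseWeight_eq_one p T S (initCore ι) (p.L + ξ) isDist_uniform
  have hcard : (0 : ℝ) < Fintype.card ι := by exact_mod_cast Fintype.card_pos
  have hgood : ∀ τ : Fin T → Option (Fin p.m → ι), GoodTranscript p g B T S (initCore ι) τ →
      (errorCount S (released T (initCore ι).wt τ) : ℝ) ≤ p.K * (B + 1) := by
    intro τ hτ
    have h := errorCount_le p hu hu1 hB0 heg hg hV T S (initCore ι) τ isDist_uniform hS ?_ ?_ ?_ ?_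
      hτ
    · simpa [initCore] using h
    · simp only [potential, initCore, one_div, Real.log_inv, neg_neg, ← Finset.sum_mul]
      have : 0 ≤ Real.log (Fintype.card ι) :=
        Real.log_nonneg (by exact_mod_cast Nat.one_le_iff_ne_zero.2 Fintype.card_ne_zero)
      simpa using mul_le_of_le_one_left this hu1
    -- Initially the released and the private weights coincide, so no sampling guarantee is needed.
    · intro t ht
      have : 0 < p.eta := p.eta_pos
      exact lt_trans (by linarith) ht
    · simp [initCore]
    · simpa [initCore] using hB0
  have hbad : ∑ τ : Fin T → Option (Fin p.m → ι), (if GoodTranscript p g B T S (initCore ι) τ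
      then 0 else initNoise p S τ * ENNReal.ofReal (sampleWeight p T S (initCore ι) τ)) ≤
      q0 + T * (3 * q0 + T * q1) := by
    have hI := sum_lintegral_noiseWeight_mul p S (initCore ι) fun τ =>
      if GoodTranscript p g B T S (initCore ι) τ then 0 else
        ENNReal.ofReal (sampleWeight p T S (initCore ι) τ)
    simp only [mul_ite, mul_zero] at hI
    have hm : MeasurableSet {ξ : ℝ | s1 < |ξ|} :=
      measurableSet_lt measurable_const measurable_id.abs
    refine le_trans (le_of_eq hI) ?_
    calc _ ≤ ∫⁻ ξ, ({ξ : ℝ | s1 < |ξ|}.indicator 1 ξ + T * (3 * q0 + T * q1))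
          ∂laplace (2 / p.epsHat) := by
          refine lintegral_mono fun ξ => ?_
          by_cases hξ : s1 < |ξ|
          · refine le_add_right ?_
            simp only [Set.mem_ofPred_eq, hξ, Set.indicator_of_mem, Pi.one_apply]
            rw [← hone ξ]
            refine Finset.sum_le_sum fun τ _ => ?_
            split_ifs <;> simp
          · refine le_add_left (le_trans (le_of_eq ?_) (sum_bad_transcripts_le p T hs1 hs2 hs2' hL
              hB hsamp T S (initCore ι) (p.L + ξ) le_rfl isDist_uniform
              (by simpa using not_lt.1 hξ)))
            congr!
      _ ≤ _ := by
          rw [lintegral_add_right _ measurable_const, lintegral_indicator_one hm,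
            lintegral_const, measure_univ, mul_one]
          gcongr
  have htot : ∑ τ : Fin T → Option (Fin p.m → ι),
      initNoise p S τ * ENNReal.ofReal (sampleWeight p T S (initCore ι) τ) = 1 := by
    have hI := sum_lintegral_noiseWeight_mul p S (initCore ι) fun τ =>
      ENNReal.ofReal (sampleWeight p T S (initCore ι) τ)
    refine hI.trans ?_
    rw [lintegral_congr hone, lintegral_const, measure_univ, mul_one]
  refine le_trans ?_ (add_le_add le_rfl hbad)
  rw [← htot, dpWinnow_apply, ← Finset.sum_add_distrib]
  refine Finset.sum_le_sum fun τ _ => ?_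
  split_ifs with hτ
  · have hmem : released T (initCore ι).wt τ ∈ {h | (errorCount S h : ℝ) ≤ p.K * (B + 1)} :=
      hgood τ hτ
    simp [hmem]
  · exact le_add_self

end Accuracy

/-! ### The choice of the parameters -/

section Parameters

lemma one_le_logOne (x : ℝ) : 1 ≤ logOne x := le_max_left _ _

lemma log_le_logOne (x : ℝ) : Real.log x ≤ logOne x := le_max_right _ _

/-- The margin of the decision lists. -/
noncomputable def listMargin (r D : ℕ) : ℝ := 1 / (2 * (r : ℝ) ^ D)

lemma listMargin_pos {r : ℕ} (hr : 1 ≤ r) (D : ℕ) : 0 < listMargin r D := by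
  unfold listMargin; positivity

lemma listMargin_le {r : ℕ} (hr : 1 ≤ r) (D : ℕ) : listMargin r D ≤ 1 := by
  have : (1 : ℝ) ≤ (r : ℝ) ^ D := one_le_pow₀ (by exact_mod_cast hr)
  unfold listMargin
  rw [div_le_one (by positivity)]
  linarith

lemma log_card_le (N : ℕ) : Real.log (2 * (N + 1)) ≤ 3 * logOne N := by
  have h1 := one_le_logOne N
  rcases Nat.eq_zero_or_pos N with rfl | hN
  · have := Real.log_two_lt_d9
    norm_num at h1 ⊢
    linarith
  · have hN' : (1 : ℝ) ≤ N := by exact_mod_cast hN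
    have h2 := log_le_logOne N
    have h4 : Real.log 4 = 2 * Real.log 2 := by
      rw [show (4 : ℝ) = 2 ^ 2 by norm_num, Real.log_pow]; norm_num
    have := Real.log_two_lt_d9
    calc Real.log (2 * (N + 1)) ≤ Real.log (4 * N) :=
          Real.log_le_log (by positivity) (by linarith)
      _ = Real.log 4 + Real.log N := Real.log_mul (by norm_num) (by positivity)
      _ ≤ _ := by linarith

lemma exp_neg_logOne_le {x : ℝ} (hx : 0 < x) : Real.exp (-logOne x) ≤ 1 / x := by
  rw [one_div, ← Real.exp_log (inv_pos.2 hx), Real.log_inv]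
  exact Real.exp_le_exp.2 (neg_le_neg (log_le_logOne x))

variable (N T r D : ℕ) (ε δ β : ℝ)

/-- The learning rate. -/
noncomputable def learningRate : ℝ :=
  -- Solves the privacy constraint: with `K` of order `1 / eta` the exponent is linear in `eta`,
  -- with constant `13 * 33 * 5 ^ 2 * 4 ^ 2 / 2 = 85800 < 110000`.
  listMargin r D ^ 3 * ε ^ 2 / (110000 * logOne N * logOne (T / β) * logOne (1 / δ))

variable {r ε}

lemma learningRate_pos (hr : 1 ≤ r) (hε : 0 < ε) : 0 < learningRate N T r D ε δ β := by
  have h1 := one_le_logOne N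
  have h2 := one_le_logOne (T / β)
  have h3 := one_le_logOne (1 / δ)
  have hg := listMargin_pos hr D
  unfold learningRate
  positivity

/-- The parameters of DP-Winnow. -/
noncomputable def winnowParams (hr : 1 ≤ r) (hε : 0 < ε) : Params where
  -- Half of the budget goes to AboveThreshold, half to the samples. `L` is the sum of the noise
  -- bounds `4 * logOne (T / β) / ε` and `8 * logOne (T / β) / ε`; `m` gives sampling failure at
  -- most `(β / T) ^ 2`; `K` just exceeds the initial potential bound divided by its decrease.
  epsHat := ε / 2
  eta := learningRate N T r D ε δ β
  L := 12 * logOne (T / β) / ε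
  m := ⌈32 * logOne (T / β) / listMargin r D ^ 2⌉₊
  K := ⌊4 * Real.log (2 * (N + 1)) / (learningRate N T r D ε δ β * listMargin r D)⌋₊ + 1
  epsHat_pos := by positivity
  eta_pos := learningRate_pos N T D δ β hr hε
  m_pos := by
    have := one_le_logOne (T / β)
    have hg := listMargin_pos hr D
    exact Nat.ceil_pos.2 (by positivity)

lemma learningRate_le (hr : 1 ≤ r) (hε : 0 < ε) (hε1 : ε < 1) :
    learningRate N T r D ε δ β ≤ listMargin r D / 4 := by
  have h1 := one_le_logOne N
  have h2 := one_le_logOne (T / β)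
  have h3 := one_le_logOne (1 / δ)
  have hg := listMargin_pos hr D
  have hg1 := listMargin_le hr D
  have hden : 110000 ≤ 110000 * logOne N * logOne (T / β) * logOne (1 / δ) := by
    have h12 : 1 ≤ logOne N * logOne (T / β) := one_le_mul_of_one_le_of_one_le h1 h2
    have h123 := one_le_mul_of_one_le_of_one_le h12 h3
    nlinarith
  have hnum : listMargin r D ^ 3 * ε ^ 2 ≤ listMargin r D := by
    have a : listMargin r D ^ 3 ≤ listMargin r D := by
      have : listMargin r D ^ 2 ≤ 1 := pow_le_one₀ hg.le hg1
      nlinarith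
    have b : ε ^ 2 ≤ 1 := pow_le_one₀ hε.le hε1.le
    calc _ ≤ listMargin r D * 1 := mul_le_mul a b (by positivity) hg.le
      _ = _ := mul_one _
  unfold learningRate
  rw [div_le_iff₀ (by linarith)]
  nlinarith

lemma winnowParams_K_le (hr : 1 ≤ r) (hε : 0 < ε) (hε1 : ε < 1) :
    ((winnowParams N T D δ β hr hε).K : ℝ) ≤
      13 * logOne N / (learningRate N T r D ε δ β * listMargin r D) := by
  have h1 := one_le_logOne N
  have hg := listMargin_pos hr D
  have hg1 := listMargin_le hr D
  have he := learningRate_pos N T D δ β hr hε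
  have he1 := learningRate_le N T D δ β hr hε hε1
  have hlog := log_card_le N
  have hlog0 : 0 ≤ Real.log (2 * ((N : ℝ) + 1)) :=
    Real.log_nonneg (by have : (0 : ℝ) ≤ N := Nat.cast_nonneg N; linarith)
  have hprod : learningRate N T r D ε δ β * listMargin r D ≤ 1 := by nlinarith
  simp only [winnowParams]
  push_cast
  have hfl := Nat.floor_le (a := 4 * Real.log (2 * (N + 1)) /
    (learningRate N T r D ε δ β * listMargin r D)) (by positivity)
  refine (add_le_add_left hfl 1).trans ?_
  rw [div_add_one (by positivity), div_le_div_iff_of_pos_right (by positivity)]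
  linarith

lemma winnowParams_lt_K (hr : 1 ≤ r) (hε : 0 < ε) :
    Real.log (2 * (N + 1)) < (winnowParams N T D δ β hr hε).K *
      (learningRate N T r D ε δ β * listMargin r D / 4) := by
  have hg := listMargin_pos hr D
  have he := learningRate_pos N T D δ β hr hε
  have h := Nat.lt_floor_add_one (4 * Real.log (2 * (N + 1)) /
    (learningRate N T r D ε δ β * listMargin r D))
  rw [div_lt_iff₀ (by positivity)] at h
  simp only [winnowParams]
  push_cast
  linarith

lemma winnowParams_m_le (hr : 1 ≤ r) (hε : 0 < ε) :
    ((winnowParams N T D δ β hr hε).m : ℝ) ≤ 33 * logOne (T / β) / listMargin r D ^ 2 := by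
  have h2 := one_le_logOne (T / β)
  have hg := listMargin_pos hr D
  have hg1 := listMargin_le hr D
  have hsq : listMargin r D ^ 2 ≤ 1 := pow_le_one₀ hg.le hg1
  have h := (Nat.ceil_lt_add_one (a := 32 * logOne (T / β) / listMargin r D ^ 2)
    (by positivity)).le
  refine h.trans ?_
  have : 1 ≤ logOne (T / β) / listMargin r D ^ 2 := by
    rw [one_le_div (by positivity)]; linarith
  have e : 33 * logOne (T / β) / listMargin r D ^ 2 =
      32 * logOne (T / β) / listMargin r D ^ 2 + logOne (T / β) / listMargin r D ^ 2 := by ring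
  linarith

/-- The sampling part of the privacy loss exceeds `ε / 2` with probability at most `δ`. -/
lemma privacy_exponent_le (hr : 1 ≤ r) (hε : 0 < ε) (hε1 : ε < 1) (hδ : 0 < δ) :
    Real.exp ((winnowParams N T D δ β hr hε).K * (winnowParams N T D δ β hr hε).m *
      ((4 * logOne (1 / δ) / ε + 1) ^ 2 * (4 * (winnowParams N T D δ β hr hε).eta) ^ 2 / 2) -
        4 * logOne (1 / δ) / ε * (ε / 2)) ≤ δ := by
  have h1 := one_le_logOne N
  have h2 := one_le_logOne (T / β)
  have h3 := one_le_logOne (1 / δ)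
  have hg := listMargin_pos hr D
  have he := learningRate_pos N T D δ β hr hε
  have hK := winnowParams_K_le N T D δ β hr hε hε1
  have hm := winnowParams_m_le N T D δ β hr hε
  have hl : 4 * logOne (1 / δ) / ε + 1 ≤ 5 * logOne (1 / δ) / ε := by
    have : 1 ≤ logOne (1 / δ) / ε := by rw [one_le_div hε]; linarith
    have e : 5 * logOne (1 / δ) / ε = 4 * logOne (1 / δ) / ε + logOne (1 / δ) / ε := by ring
    linarith
  have heta : (winnowParams N T D δ β hr hε).eta = learningRate N T r D ε δ β := rfl
  have hmain : (winnowParams N T D δ β hr hε).K * (winnowParams N T D δ β hr hε).m *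
      ((4 * logOne (1 / δ) / ε + 1) ^ 2 * (4 * (winnowParams N T D δ β hr hε).eta) ^ 2 / 2) ≤
      logOne (1 / δ) := by
    rw [heta]
    calc _ ≤ (13 * logOne N / (learningRate N T r D ε δ β * listMargin r D)) *
          (33 * logOne (T / β) / listMargin r D ^ 2) *
          ((5 * logOne (1 / δ) / ε) ^ 2 * (4 * learningRate N T r D ε δ β) ^ 2 / 2) := by
          gcongr
      _ = 85800 * logOne N * logOne (T / β) * logOne (1 / δ) ^ 2 / (listMargin r D ^ 3 * ε ^ 2) *
          learningRate N T r D ε δ β := by field_simp; ring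
      _ = 85800 / 110000 * logOne (1 / δ) := by unfold learningRate; field_simp
      _ ≤ logOne (1 / δ) := by linarith
  have hle : 4 * logOne (1 / δ) / ε * (ε / 2) = 2 * logOne (1 / δ) := by field_simp; norm_num
  rw [hle]
  calc _ ≤ Real.exp (-logOne (1 / δ)) := Real.exp_le_exp.2 (by linarith)
    _ ≤ 1 / (1 / δ) := exp_neg_logOne_le (by positivity)
    _ = δ := one_div_one_div δ

/-- Updates times errors per update: the product has order `r ^ (4 * D)`, squared logarithms of `N`
and `T / β`, a single `logOne (1 / δ)` and `ε⁻³`. All these powers are below those of `mainTerm`;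
the constant is `13 * 25 * 110000 * 2 ^ 4`. -/
lemma error_bound_le (hr : 1 ≤ r) (hε : 0 < ε) (hε1 : ε < 1) :
    (winnowParams N T D δ β hr hε).K * (24 * logOne (T / β) / ε + 1) ≤
      572000000 * mainTerm N T r D ε δ β := by
  have h1 := one_le_logOne N
  have h2 := one_le_logOne (T / β)
  have h3 := one_le_logOne (1 / δ)
  have hg := listMargin_pos hr D
  have he := learningRate_pos N T D δ β hr hε
  have hK := winnowParams_K_le N T D δ β hr hε hε1
  have hr1 : (1 : ℝ) ≤ r := by exact_mod_cast hr
  have hB : 24 * logOne (T / β) / ε + 1 ≤ 25 * logOne (T / β) / ε := by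
    have : 1 ≤ logOne (T / β) / ε := by rw [one_le_div hε]; linarith
    have e : 25 * logOne (T / β) / ε = 24 * logOne (T / β) / ε + logOne (T / β) / ε := by ring
    linarith
  have hR : ((r : ℝ) ^ D) ^ 4 ≤ (r : ℝ) ^ (6 * D) := by
    rw [← pow_mul]
    exact pow_le_pow_right₀ hr1 (by omega)
  have hN : logOne N ^ 2 ≤ logOne N ^ 3 := pow_le_pow_right₀ h1 (by norm_num)
  have hT : logOne (T / β) ^ 2 ≤ logOne (T / β) ^ (5 / 2 : ℝ) := by
    rw [← Real.rpow_natCast]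
    exact Real.rpow_le_rpow_of_exponent_le h2 (by norm_num)
  have hD : logOne (1 / δ) ≤ logOne (1 / δ) ^ 2 := le_self_pow₀ h3 (by norm_num)
  have hE : ε ^ 4 ≤ ε ^ 3 := pow_le_pow_of_le_one hε.le hε1.le (by norm_num)
  have hRpos : 0 < (r : ℝ) ^ D := by positivity
  calc _ ≤ (13 * logOne N / (learningRate N T r D ε δ β * listMargin r D)) *
        (25 * logOne (T / β) / ε) := by gcongr
    _ = 572000000 * (((r : ℝ) ^ D) ^ 4 * logOne N ^ 2 * logOne (T / β) ^ 2 * logOne (1 / δ) /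
        ε ^ 3) := by
        unfold learningRate listMargin; field_simp; norm_num
    _ ≤ _ := by
        unfold mainTerm
        gcongr

end Parameters

lemma errors_eq_errorCount {X : Type u} (F : Finset (X → Bool)) {T : ℕ} (S : Fin T → X × Bool)
    (h : Fin T → Coord F → ℝ) :
    errors F S h = errorCount (fun t => (expand F (S t).1, (S t).2)) h := by
  rw [errors, errorCount, Finset.card_filter]

lemma Neighbors.map {T : ℕ} {Z Z' : Type*} {S S' : Fin T → Z} (h : Neighbors S S') (f : Z → Z') :
    Neighbors (fun t => f (S t)) fun t => f (S' t) := by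
  obtain ⟨i, hi⟩ := h
  exact ⟨i, fun j hj => congrArg f (hi j hj)⟩

lemma card_coord {X : Type u} (F : Finset (X → Bool)) :
    Fintype.card (Coord F) = 2 * (F.card + 1) := by
  simp [Coord, two_mul]

lemma learner_isDP {X : Type u} (F : Finset (X → Bool)) (N T D : ℕ) {r : ℕ} {ε δ : ℝ} (β : ℝ)
    (hr : 1 ≤ r) (hε : 0 < ε) (hε1 : ε < 1) (hδ : 0 < δ) :
    IsDP ε δ fun S : Fin T → X × Bool => learner F (winnowParams N T D δ β hr hε) S := by
  intro S S' hS R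
  have h3 := one_le_logOne (1 / δ)
  have h := dpWinnow_le (winnowParams N T D δ β hr hε)
    (hS.map fun z : X × Bool => (expand F z.1, z.2)) (l := 4 * logOne (1 / δ) / ε) (e := ε / 2)
    (by positivity) R
  refine h.trans (add_le_add (le_of_eq ?_)
    (ENNReal.ofReal_le_ofReal (privacy_exponent_le N T D δ β hr hε hε1 hδ)))
  rw [show (winnowParams N T D δ β hr hε).epsHat = ε / 2 from rfl, add_halves]
  rfl

lemma learner_accuracy {X : Type u} (F : Finset (X → Bool)) (T D : ℕ) {r : ℕ} {ε β : ℝ} (δ : ℝ)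
    (hT : 1 ≤ T) (hr : 1 ≤ r) (hε : 0 < ε) (hε1 : ε < 1) (hβ : 0 < β) (hβ1 : β < 1)
    {c : X → Bool} (hc : c ∈ decisionLists F r D) (S : Fin T → X × Bool)
    (hS : ∀ t, (S t).2 = c (S t).1) :
    ENNReal.ofReal (1 - 9 * β) ≤ learner F (winnowParams F.card T D δ β hr hε) S
      {h | (errors F S h : ℝ) ≤ 572000000 * mainTerm F.card T r D ε δ β} := by
  obtain ⟨u, hu, hu1, hmarg⟩ := exists_margin hr hc
  set p := winnowParams F.card T D δ β hr hε with hp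
  set l := logOne (T / β) with hl
  have hl1 : 1 ≤ l := one_le_logOne _
  have hT0 : (0 : ℝ) < T := by exact_mod_cast hT
  have hexp : Real.exp (-l) ≤ β / T := by
    have := exp_neg_logOne_le (x := T / β) (by positivity)
    rwa [one_div_div] at this
  have hg := listMargin_pos hr D
  have heps : p.epsHat = ε / 2 := rfl
  -- The noise bound `a * l / ε` is `l` times the Laplace scale, for `a = 4` (threshold) and `a = 8`
  -- (query).
  have hq : ∀ a : ℝ, 0 < a → ENNReal.ofReal (Real.exp (-(a * l / ε) / (a / 2 / (ε / 2)))) ≤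
      ENNReal.ofReal (β / T) := by
    intro a ha
    refine ENNReal.ofReal_le_ofReal (le_trans (le_of_eq ?_) hexp)
    congr 1
    field_simp
  have hacc := one_le_dpWinnow_add p (fun t => (expand F (S t).1, (S t).2)) hu hu1
    (g := listMargin r D) (B := 24 * l / ε) (s1 := 4 * l / ε) (s2 := 8 * l / ε)
    (q0 := 2 * ENNReal.ofReal (β / T)) (q1 := ENNReal.ofReal ((β / T) ^ 2)) (by positivity)
    (learningRate_le _ T D δ β hr hε hε1) (listMargin_le hr D)
    (fun t => by simp only [hS t]; exact hmarg (S t).1)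
    (by rw [card_coord]; push_cast; exact winnowParams_lt_K F.card T D δ β hr hε)
    (by
      rw [heps]
      refine (laplace_abs_tail (by positivity) (by positivity)).trans (mul_le_mul_right ?_ _)
      have := hq 4 (by norm_num)
      norm_num at this ⊢
      exact this)
    (by
      rw [heps]
      refine (laplace_upper_tail (by positivity) (by positivity)).trans ?_
      have := hq 8 (by norm_num)
      norm_num at this ⊢
      exact this.trans (le_mul_of_one_le_left zero_le one_le_two))
    (by
      rw [heps]
      refine (laplace_lower_tail (by positivity) (by positivity)).trans ?_
      have := hq 8 (by norm_num)
      norm_num at this ⊢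
      exact this.trans (le_mul_of_one_le_left zero_le one_le_two))
    (le_of_eq (by simp only [hp, winnowParams]; ring))
    (le_of_eq (by simp only [hp, winnowParams]; ring))
    (by
      intro w hw z hz
      have hm : 32 * l / listMargin r D ^ 2 ≤ p.m := Nat.le_ceil _
      have h := sum_bad_samples_le hw hg (listMargin_le hr D) p.m_pos z hz
        (fun J => margin (empirical J) z ≤ 0) fun J hJ => hJ
      have hle : Real.exp (-(p.m * listMargin r D ^ 2 / 16)) ≤ (β / T) ^ 2 := by
        rw [div_le_iff₀ (by positivity)] at hm
        calc _ ≤ Real.exp (2 * -l) := Real.exp_le_exp.2 (by linarith)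
          _ = Real.exp (-l) ^ 2 := by rw [← Real.exp_nat_mul]; norm_num
          _ ≤ _ := by gcongr
      refine le_trans (le_of_eq ?_) (ENNReal.ofReal_le_ofReal (h.trans hle))
      rw [ENNReal.ofReal_sum_of_nonneg fun J _ => ?_]
      · refine Finset.sum_congr rfl fun J _ => ?_
        split_ifs <;> simp
      · have := Finset.prod_pos fun i (_ : i ∈ Finset.univ) => hw.pos (J i)
        split_ifs
        · exact this.le
        · exact le_rfl)
  have hfail : 2 * ENNReal.ofReal (β / T) + T * (3 * (2 * ENNReal.ofReal (β / T)) +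
      T * ENNReal.ofReal ((β / T) ^ 2)) ≤ ENNReal.ofReal (9 * β) := by
    have e : 2 * ENNReal.ofReal (β / T) + T * (3 * (2 * ENNReal.ofReal (β / T)) +
        T * ENNReal.ofReal ((β / T) ^ 2)) = ENNReal.ofReal (2 * (β / T) +
          T * (3 * (2 * (β / T)) + T * (β / T) ^ 2)) := by
      rw [ENNReal.ofReal_add (by positivity) (by positivity), ENNReal.ofReal_mul (by norm_num),
        ENNReal.ofReal_mul (by positivity), ENNReal.ofReal_add (by positivity) (by positivity),
        ENNReal.ofReal_mul (by norm_num), ENNReal.ofReal_mul (by norm_num),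
        ENNReal.ofReal_mul (by positivity)]
      simp
    rw [e]
    refine ENNReal.ofReal_le_ofReal ?_
    have e2 : 2 * (β / T) + T * (3 * (2 * (β / T)) + T * (β / T) ^ 2) =
        2 * (β / T) + 6 * β + β ^ 2 := by field_simp; ring
    have h1 : β / T ≤ β := div_le_self hβ.le (by exact_mod_cast hT)
    rw [e2]
    nlinarith
  rw [ENNReal.ofReal_sub _ (by positivity), ENNReal.ofReal_one, tsub_le_iff_right]
  refine hacc.trans (add_le_add (measure_mono fun h hh => ?_) hfail)
  simp only [Set.mem_ofPred_eq, errors_eq_errorCount] at hh ⊢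
  exact hh.trans (error_bound_le F.card T D δ β hr hε hε1)

end DPWinnow

theorem mainTheorem8 :
    ∃ (A B : ℝ) (a : ℕ), ∀ (N T r D : ℕ) (ε δ β : ℝ), 1 ≤ T → 1 ≤ r →
      0 < ε → ε < 1 → 0 < δ → δ < 1 → 0 < β → β < 1 →
      ∃ p : DPWinnow.Params, ∀ (X : Type u) (F : Finset (X → Bool)), F.card = N →
        DPWinnow.IsDP ε δ (fun S : Fin T → X × Bool => DPWinnow.learner F p S) ∧
        ∀ c ∈ DPWinnow.decisionLists F r D, ∀ S : Fin T → X × Bool,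
          (∀ t, (S t).2 = c (S t).1) →
          ENNReal.ofReal (1 - B * β) ≤
            DPWinnow.learner F p S
              {h | (DPWinnow.errors F S h : ℝ) ≤
                A * DPWinnow.mainTerm N T r D ε δ β *
                  DPWinnow.logOne (DPWinnow.mainTerm N T r D ε δ β) ^ a} := by
  -- The bound holds without a further logarithmic factor, so the exponent is `0`; the failure
  -- probability is at most `2 * β / T + 6 * β + β ^ 2 ≤ 9 * β`.
  refine ⟨572000000, 9, 0, fun N T r D ε δ β hT hr hε hε1 hδ _ hβ hβ1 =>
    ⟨DPWinnow.winnowParams N T D δ β hr hε, fun X F hF => ⟨?_, fun c hc S hS => ?_⟩⟩⟩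
  · exact DPWinnow.learner_isDP F N T D β hr hε hε1 hδ
  · subst hF
    simpa only [pow_zero, mul_one] using
      DPWinnow.learner_accuracy F T D δ hT hr hε hε1 hβ hβ1 hc S hS
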